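/- An instance of the Steiner Ring Augmentation Problem (SRAP) consists of a finite vertex set $V$, a cycle (the ring) $H=(V(H),E)$ with $V(H)\subseteq V$, a finite set $L$ of links, disjoint from $E$, each joining two vertices of $V$ (parallel edges are allowed), link costs $c:L\to\mathbb{R}_{\ge 0}$, and a set of terminals $R\subseteq V(H)$. A set $S\subseteq L$ is a solution if in the graph $(V,E\cup S)$ there are three pairwise edge-disjoint paths between any two distinct terminals; its cost is $c(S)=\sum_{\ell\in S}c(\ell)$. A full component is a tree $K$ formed by a nonempty set of links, all of whose leaves are ring nodes (vertices of $V(H)$) and all of whose internal vertices lie in $V\setminus V(H)$; it joins the ring nodes that it contains. A dangerous ring-cut is a set $C\subseteq V(H)$ with $|\delta_E(C)|=2$ such that both $C\cap R$ and $R\setminus C$ are nonempty; it is covered by $K$ if $K$ joins some ring node in $C$ and some ring node outside $C$. For $\gamma\in\mathbb{N}$, a $\gamma$-restricted solution is a finite collection $F$ of full components, each joining at most $\gamma$ ring nodes, such that every dangerous ring-cut is covered by some member of $F$ and the union of the link sets of the members of $F$ is a solution. Members of $F$ may share links and vertices, and the cost is $c(F)=\sum_{K\in F}c(K)$, so a link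 is paid for once in each member that uses it. Let $\varepsilon>0$ and $\gamma=2^{\lceil 1/\varepsilon\rceil}$, and let $S^*$ be a solution of minimum cost. Then a $\gamma$-restricted solution of minimum cost exists, and every such $S_\gamma$ satisfies $$c(S_\gamma)\le(1+\varepsilon)\,c(S^*).$$ -/

import Mathlib

namespace SRAP

/-! ### Finite multigraphs, given by an endpoint map `ends : E → Sym2 V` -/

/-- The cut `δ(C)`: all edges with exactly one endpoint in `C`. -/
def cut {V E : Type*} (ends : E → Sym2 V) (C : Set V) : Set E :=
  {e | ∃ u ∈ C, ∃ v, v ∉ C ∧ ends e = s(u, v)}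

/-- `IsWalk ends u p v`: the list `p` of steps (edge traversed, vertex reached) is a walk
from `u` to `v`. -/
def IsWalk {V E : Type*} (ends : E → Sym2 V) : V → List (E × V) → V → Prop
  | u, [], v => u = v
  | u, (e, w) :: p, v => ends e = s(u, w) ∧ IsWalk ends w p v

/-- A path is a walk that repeats no vertex. -/
def IsPath {V E : Type*} (ends : E → Sym2 V) (u : V) (p : List (E × V)) (v : V) : Prop :=
  IsWalk ends u p v ∧ (u :: p.map Prod.snd).Nodup

/-- The graph with edge set `X` has `k` pairwise edge-disjoint paths between `u` and `v`. -/
def HasEdgeDisjointPaths {V E : Type*} (ends : E → Sym2 V) (X : Set E) (k : ℕ) (u v : V) : Prop :=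
  ∃ P : Fin k → List (E × V),
    (∀ i, IsPath ends u (P i) v ∧ ∀ e ∈ (P i).map Prod.fst, e ∈ X) ∧
    Pairwise fun i j => ((P i).map Prod.fst).Disjoint ((P j).map Prod.fst)

/-- The vertices incident with some edge of `K`. -/
def verts {V E : Type*} (ends : E → Sym2 V) (K : Set E) : Set V :=
  {v | ∃ e ∈ K, v ∈ ends e}

/-- The number of edges of `K` incident with `v` (loops never occur where this is used). -/
noncomputable def degree {V E : Type*} (ends : E → Sym2 V) (K : Set E) (v : V) : ℕ :=
  {e ∈ K | v ∈ ends e}.ncard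

/-- `K` is the edge set of a tree with at least one edge: it has no loops, no parallel edges, and
the simple graph that it forms on the vertices it is incident with is a tree. -/
structure IsEdgeTree {V E : Type*} (ends : E → Sym2 V) (K : Set E) : Prop where
  nonempty : K.Nonempty
  no_loop : ∀ e ∈ K, ¬ (ends e).IsDiag
  no_parallel : Set.InjOn ends K
  isTree : ((SimpleGraph.fromEdgeSet (ends '' K)).induce (verts ends K)).IsTree

/-! ### The Steiner Ring Augmentation Problem -/

/-- An instance of SRAP with vertex set `V` and link set `L`. The ring is the cycle through the
distinct vertices `ring i`, `i : ZMod n`, with edges `ring i — ring (i + 1)`, one for each `i`.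
The links may be parallel to each other and to ring edges. -/
structure Instance (V L : Type*) where
  /-- The length of the ring. -/
  n : ℕ
  n_pos : 0 < n
  /-- The vertices of the ring, in cyclic order. -/
  ring : ZMod n → V
  ring_injective : Function.Injective ring
  /-- The two endpoints of a link. -/
  ends : L → Sym2 V
  /-- The cost of a link. -/
  cost : L → ℝ
  cost_nonneg : ∀ l, 0 ≤ cost l
  /-- The terminals. -/
  R : Set V
  R_subset : R ⊆ Set.range ring

namespace Instance

variable {V L : Type*} (I : Instance V L)

/-- The set `V(H)` of ring nodes. -/
def ringNodes : Set V := Set.range I.ring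

/-- Endpoints of the ring edges. -/
def ringEnds (i : ZMod I.n) : Sym2 V := s(I.ring i, I.ring (i + 1))

/-- Endpoints of the edges of the whole graph `(V, E ∪ L)`, a disjoint union. -/
def allEnds : ZMod I.n ⊕ L → Sym2 V := Sum.elim I.ringEnds I.ends

/-- A set `S` of links is a (feasible) solution if `(V, E ∪ S)` has three pairwise edge-disjoint
paths between any two terminals. -/
def IsSolution (S : Set L) : Prop :=
  ∀ u ∈ I.R, ∀ v ∈ I.R, u ≠ v →
    HasEdgeDisjointPaths I.allEnds (Set.range Sum.inl ∪ Sum.inr '' S) 3 u v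

/-- The cost of a set of links. -/
noncomputable def linkCost (S : Finset L) : ℝ := ∑ l ∈ S, I.cost l

/-- `S` is an optimal solution. -/
def IsOptimal (S : Finset L) : Prop :=
  I.IsSolution (S : Set L) ∧
    ∀ S' : Finset L, I.IsSolution (S' : Set L) → I.linkCost S ≤ I.linkCost S'

/-- Dangerous ring-cuts: the 2-cuts of the ring that separate two terminals. (Coverage below is
symmetric under complementation in the ring, so no root is needed to choose one of the two
sides.) -/
def IsDangerousRingCut (C : Set V) : Prop :=
  C ⊆ I.ringNodes ∧ (cut I.ringEnds C).ncard = 2 ∧ (C ∩ I.R).Nonempty ∧ (I.R \ C).Nonempty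

/-- A full component: a tree of links whose leaves are ring nodes and whose internal vertices are
not ring nodes. -/
def IsFullComponent (K : Set L) : Prop :=
  IsEdgeTree I.ends K ∧
    ∀ v ∈ verts I.ends K, v ∈ I.ringNodes ↔ degree I.ends K v = 1

/-- The ring nodes that a full component joins. -/
def joined (K : Set L) : Set V := verts I.ends K ∩ I.ringNodes

/-- The full component `K` covers the cut `C` if it joins a ring node in `C` to one outside `C`. -/
def Covers (K : Set L) (C : Set V) : Prop :=
  (I.joined K ∩ C).Nonempty ∧ (I.joined K \ C).Nonempty

/-- A solution made up of full components, each joining at most `γ` ring nodes. Connectivity is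
provided by the full components as such (each dangerous ring-cut is covered by a single one of
them), not by vertices outside the ring or links that two of them happen to share. -/
structure IsRestrictedSolution (γ : ℕ) (F : Finset (Finset L)) : Prop where
  isFullComponent : ∀ K ∈ F, I.IsFullComponent (K : Set L)
  card_joined_le : ∀ K ∈ F, (I.joined (K : Set L)).ncard ≤ γ
  covers : ∀ C, I.IsDangerousRingCut C → ∃ K ∈ F, I.Covers (K : Set L) C
  isSolution : I.IsSolution {l | ∃ K ∈ F, l ∈ K}

/-- The cost of a collection of full components: a link is paid for in each of them. -/
noncomputable def componentsCost (F : Finset (Finset L)) : ℝ := ∑ K ∈ F, I.linkCost K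

/-- `F` is an optimal `γ`-restricted solution. -/
def IsOptimalRestricted (γ : ℕ) (F : Finset (Finset L)) : Prop :=
  I.IsRestrictedSolution γ F ∧
    ∀ F', I.IsRestrictedSolution γ F' → I.componentsCost F ≤ I.componentsCost F'

end Instance

end SRAP

/-! By the cut form of Menger's theorem, covering every dangerous ring-cut is enough for
feasibility: a cut that separates two terminals contains at least two ring edges, and if it contains
exactly two, its trace on the ring is dangerous, so a covering component adds a link to it
(`isSolution_of_covers`). Conversely, every dangerous cut is bridged by a solution `S`, either by
one link between ring nodes or through vertices outside the ring (`IsSolution.exists_connection`).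
It therefore suffices to replace these connections of `S` by small full components.

For each class of mutually reachable non-ring vertices, `exists_steinerTree` extracts a rooted
binary tree that pays for each link at most once. With `k = ⌈1/ε⌉`, such a tree is cut after every
`k` levels of branching, and the piece above each cut is continued by a path down to a leaf, so that
consecutive pieces stay linked through a common leaf and together still cover every ring-cut that
the tree covers. Pieces have at most `2 ^ k` leaves. Over the `k` possible offsets of the first cut,
each branching is cut exactly once, and the added paths are pairwise disjoint, so all additions
together cost at most one copy of the tree (`sum_splitCost`). Some offset then costs at most `1 +
1/k ≤ 1 + ε` times the tree.

A piece may repeat links or vertices when mapped to the graph. An inclusion-minimal subset of its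
links that still spans its leaves is a genuine full component joining exactly those leaves
(`Spans.exists_isFullComponent`). -/

namespace SRAP

/-! ### Menger's theorem for edge-disjoint paths in finite multigraphs -/

/-- The list `p` of steps leads from `u` to `v`, each step being allowed by `r`. -/
def StepWalk {V E : Type*} (r : V → E → V → Prop) : V → List (E × V) → V → Prop
  | u, [], v => u = v
  | u, (e, w) :: p, v => r u e w ∧ StepWalk r w p v

section Walks

variable {V E : Type*} {r : V → E → V → Prop}

lemma StepWalk.isWalk {ends : E → Sym2 V} (h : ∀ x e y, r x e y → ends e = s(x, y)) :
    ∀ {p : List (E × V)} {u v : V}, StepWalk r u p v → IsWalk ends u p v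
  | [], _, _, hp => hp
  | (_, _) :: _, _, _, hp => ⟨h _ _ _ hp.1, StepWalk.isWalk h hp.2⟩

lemma StepWalk.exists_suffix : ∀ {p : List (E × V)} {w v x : V}, StepWalk r w p v →
    x ∈ w :: p.map Prod.snd →
      ∃ q, StepWalk r x q v ∧ List.Sublist (x :: q.map Prod.snd) (w :: p.map Prod.snd)
  | [], w, v, x, hp, hx => by
    obtain rfl : x = w := by simpa using hx
    exact ⟨[], hp, List.Sublist.refl _⟩
  | (e, y) :: p, w, v, x, hp, hx => by
    rcases List.mem_cons.1 hx with rfl | hx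
    · exact ⟨_, hp, List.Sublist.refl _⟩
    · obtain ⟨q, hq, hs⟩ := StepWalk.exists_suffix hp.2 (by simpa using hx)
      exact ⟨q, hq, hs.trans (List.sublist_cons_self _ _)⟩

/-- When a new step starts at a vertex already on the walk, the suffix from that vertex replaces the
whole walk, which removes the cycle. -/
lemma exists_stepWalk_nodup {u v : V}
    (h : Relation.ReflTransGen (fun x y => ∃ e, r x e y) u v) :
    ∃ p, StepWalk r u p v ∧ (u :: p.map Prod.snd).Nodup := by
  induction h using Relation.ReflTransGen.head_induction_on with
  | refl => exact ⟨[], rfl, by simp⟩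
  | @head a c hac _ ih =>
    obtain ⟨p, hp, hn⟩ := ih
    obtain ⟨e, he⟩ := hac
    by_cases ha : a ∈ c :: p.map Prod.snd
    · obtain ⟨q, hq, hs⟩ := hp.exists_suffix ha
      exact ⟨q, hq, hn.sublist hs⟩
    · exact ⟨(e, c) :: p, ⟨he, hp⟩, List.nodup_cons.2 ⟨ha, hn⟩⟩

lemma IsWalk.mem_of_mem_ends {ends : E → Sym2 V} : ∀ {p : List (E × V)} {u v : V},
    IsWalk ends u p v → ∀ e ∈ p.map Prod.fst, ∀ x ∈ ends e, x ∈ u :: p.map Prod.snd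
  | [], _, _, _, e, he, _, _ => by simp at he
  | (e', w) :: p, u, v, hp, e, he, x, hx => by
    rcases List.mem_cons.1 he with rfl | he
    · have hx' : x ∈ s(u, w) := hp.1 ▸ hx
      rcases Sym2.mem_iff.1 hx' with rfl | rfl <;> simp
    · exact List.mem_cons_of_mem _ (IsWalk.mem_of_mem_ends hp.2 e he x hx)

/-- A walk from a set to its complement uses an edge of the cut. -/
lemma IsWalk.exists_mem_cut {ends : E → Sym2 V} {C : Set V} : ∀ {p : List (E × V)} {u v : V},
    IsWalk ends u p v → u ∈ C → v ∉ C → ∃ e ∈ p.map Prod.fst, e ∈ cut ends C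
  | [], _, _, hp, hu, hv => absurd (hp ▸ hu) hv
  | (e, w) :: p, u, v, hp, hu, hv => by
    by_cases hw : w ∈ C
    · obtain ⟨e', he', hc⟩ := IsWalk.exists_mem_cut hp.2 hw hv
      exact ⟨e', List.mem_cons_of_mem _ he', hc⟩
    · exact ⟨e, by simp, u, hu, w, hw, hp.1⟩

end Walks

/-! ### Unit flows, augmentation and decomposition into paths. -/

section Flow

open scoped Classical in
/-- The net flow out of `x`, for a flow `f` on edges directed from `tail` to `head`. -/
noncomputable def netOut {V E : Type*} [Fintype E] (tail head : E → V) (f : E → ℤ) (x : V) : ℤ :=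
  ∑ e, f e * ((if tail e = x then 1 else 0) - (if head e = x then 1 else 0))

/-- One can step from `x` to `y` along `e` in the direction `s = ± 1`, and `P e s` holds. -/
def DirStep {V E : Type*} (tail head : E → V) (P : E → ℤ → Prop) (x : V) (e : E) (y : V) : Prop :=
  (P e 1 ∧ tail e = x ∧ head e = y) ∨ (P e (-1) ∧ head e = x ∧ tail e = y)

variable {V E : Type*} {tail head : E → V}

lemma DirStep.ends_eq {ends : E → Sym2 V} (hends : ∀ e, ends e = s(tail e, head e))
    {P : E → ℤ → Prop} {x : V} {e : E} {y : V} (h : DirStep tail head P x e y) :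
    ends e = s(x, y) := by
  rcases h with ⟨_, rfl, rfl⟩ | ⟨_, rfl, rfl⟩
  · exact hends e
  · rw [hends e, Sym2.eq_swap]

variable [Fintype E]

lemma netOut_add (f g : E → ℤ) (x : V) :
    netOut tail head (f + g) x = netOut tail head f x + netOut tail head g x := by
  simp [netOut, add_mul, Finset.sum_add_distrib]

lemma netOut_sub (f g : E → ℤ) (x : V) :
    netOut tail head (f - g) x = netOut tail head f x - netOut tail head g x := by
  simp only [netOut, Pi.sub_apply, sub_mul (f _), Finset.sum_sub_distrib]

open scoped Classical in
lemma netOut_single (e : E) (c : ℤ) (x : V) :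
    netOut tail head (Pi.single e c) x =
      c * ((if tail e = x then 1 else 0) - (if head e = x then 1 else 0)) := by
  unfold netOut
  rw [Finset.sum_eq_single e]
  · simp
  · intro b _ hb
    simp [Pi.single_eq_of_ne hb]
  · simp

open scoped Classical in
lemma sum_netOut [Fintype V] (f : E → ℤ) (C : Set V) :
    ∑ x with x ∈ C, netOut tail head f x =
      ∑ e, f e * ((if tail e ∈ C then 1 else 0) - (if head e ∈ C then 1 else 0)) := by
  unfold netOut
  rw [Finset.sum_comm]
  refine Finset.sum_congr rfl fun e _ => ?_
  rw [← Finset.mul_sum, Finset.sum_sub_distrib]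
  simp [Finset.sum_ite_eq]

-- Turns a path into a flow of value one. A vertex-simple path uses each edge once, so values stay
-- `± 1`. The predicate `P` remembers in which direction an edge may be used; it serves both for
-- residual walks and for walks along a flow.
open scoped Classical in
lemma exists_pathFlow {P : E → ℤ → Prop} : ∀ {p : List (E × V)} {u v : V},
    StepWalk (DirStep tail head P) u p v → (u :: p.map Prod.snd).Nodup →
      ∃ g : E → ℤ, (∀ e ∉ p.map Prod.fst, g e = 0) ∧
        (∀ e ∈ p.map Prod.fst, (g e = 1 ∨ g e = -1) ∧ P e (g e)) ∧
        ∀ x, netOut tail head g x = (if u = x then 1 else 0) - (if v = x then 1 else 0)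
  | [], u, v, hp, _ => by
    obtain rfl : u = v := hp
    exact ⟨0, by simp, by simp, by simp [netOut]⟩
  | (e, w) :: p, u, v, hp, hn => by
    obtain ⟨hu, hn⟩ := List.nodup_cons.1 hn
    obtain ⟨g, h0, h1, hg⟩ := exists_pathFlow hp.2 hn
    have hw : IsWalk (fun e => s(tail e, head e)) w p v :=
      hp.2.isWalk fun _ _ _ h => h.ends_eq fun _ => rfl
    have he : e ∉ p.map Prod.fst := fun he => hu <| hw.mem_of_mem_ends e he u <| by
      rcases hp.1 with ⟨_, rfl, _⟩ | ⟨_, rfl, _⟩ <;> simp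
    obtain ⟨s, hs, hPs, hse⟩ : ∃ s : ℤ, (s = 1 ∨ s = -1) ∧ P e s ∧
        ∀ x, netOut tail head (Pi.single e s) x =
          (if u = x then 1 else 0) - (if w = x then 1 else 0) := by
      rcases hp.1 with ⟨hP, rfl, rfl⟩ | ⟨hP, rfl, rfl⟩
      · exact ⟨1, .inl rfl, hP, fun x => by rw [netOut_single, one_mul]⟩
      · exact ⟨-1, .inr rfl, hP, fun x => by rw [netOut_single]; ring⟩
    refine ⟨Pi.single e s + g, fun e' he' => ?_, fun e' he' => ?_, fun x => ?_⟩
    · simp only [List.map_cons, List.mem_cons, not_or] at he'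
      simp [Pi.single_eq_of_ne he'.1, h0 e' he'.2]
    · by_cases hee : e' = e
      · subst hee
        simpa [h0 _ he] using ⟨hs, hPs⟩
      · have := h1 e' (by simpa [hee] using he')
        simpa [Pi.single_eq_of_ne hee] using this
    · rw [netOut_add, hse, hg]
      ring

/-- `f` is a flow of value `k` from `u` to `v` with unit capacities, supported in `X`. -/
structure IsUnitFlow (tail head : E → V) (X : Set E) (u v : V) (k : ℤ) (f : E → ℤ) : Prop where
  range : ∀ e, f e = 0 ∨ f e = 1 ∨ f e = -1
  support : ∀ e ∉ X, f e = 0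
  netOut_source : netOut tail head f u = k
  netOut_eq_zero : ∀ x, x ≠ u → x ≠ v → netOut tail head f x = 0

-- Summing conservation over `C` leaves only the source, so the whole value crosses the cut. Nothing
-- is required at `v`, which lies outside `C`.
open scoped Classical in
lemma IsUnitFlow.sum_cut [Finite V] {X : Set E} {u v : V} {k : ℤ} {f : E → ℤ}
    (hf : IsUnitFlow tail head X u v k f) {C : Set V} (hu : u ∈ C) (hv : v ∉ C) :
    ∑ e, f e * ((if tail e ∈ C then 1 else 0) - (if head e ∈ C then 1 else 0)) = k := by
  have := Fintype.ofFinite V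
  rw [← sum_netOut, Finset.sum_eq_single u, hf.netOut_source]
  · intro x hx hxu
    refine hf.netOut_eq_zero x hxu ?_
    rintro rfl
    exact hv (by simpa using hx)
  · intro h
    simp [hu] at h

/-- Ford–Fulkerson step: either `v` is reachable in the residual network and a path flow is added,
or the reachable set is a cut of size `k`. -/
lemma IsUnitFlow.augment [Finite V] {X : Set E} {u v : V} (huv : u ≠ v) {k : ℕ} {f : E → ℤ}
    (hf : IsUnitFlow tail head X u v k f)
    (hcut : ∀ C : Set V, u ∈ C → v ∉ C →
      k < (X ∩ cut (fun e => s(tail e, head e)) C).ncard) :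
    ∃ g, IsUnitFlow tail head X u v ((k + 1 : ℕ) : ℤ) g := by
  classical
  -- Residual capacity: direction `s` is blocked only if `f` already uses it. Adding `± 1` under
  -- this condition keeps values in `{-1, 0, 1}`.
  set P : E → ℤ → Prop := fun e s => e ∈ X ∧ f e ≠ s with hP
  set C : Set V :=
    {x | Relation.ReflTransGen (fun x y => ∃ e, DirStep tail head P x e y) u x} with hC
  have huC : u ∈ C := Relation.ReflTransGen.refl
  by_cases hvC : v ∈ C
  · obtain ⟨p, hp, hn⟩ := exists_stepWalk_nodup hvC
    obtain ⟨g, h0, h1, hg⟩ := exists_pathFlow hp hn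
    refine ⟨f + g, fun e => ?_, fun e he => ?_, ?_, fun x hxu hxv => ?_⟩
    · by_cases he : e ∈ p.map Prod.fst
      · have h2 := h1 e he
        have h3 := hf.range e
        have h4 := h2.2.2
        simp only [Pi.add_apply]
        omega
      · simpa [h0 e he] using hf.range e
    · have : e ∉ p.map Prod.fst := fun h => he (h1 e h).2.1
      simp [h0 e this, hf.support e he]
    · rw [netOut_add, hf.netOut_source, hg]
      simp [huv.symm]
    · rw [netOut_add, hf.netOut_eq_zero x hxu hxv, hg]
      simp [hxu.symm, hxv.symm]
  · exfalso
    have h := hf.sum_cut huC hvC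
    have hlt := hcut C huC hvC
    have hcard : ∑ e, f e * ((if tail e ∈ C then 1 else 0) - (if head e ∈ C then 1 else 0)) =
        ∑ e, if e ∈ X ∩ cut (fun e => s(tail e, head e)) C then (1 : ℤ) else 0 := by
      refine Finset.sum_congr rfl fun e _ => ?_
      by_cases heX : e ∈ X
      swap
      · simp [heX, hf.support e heX]
      have hin : e ∈ X ∩ cut (fun e => s(tail e, head e)) C ↔ ¬ (tail e ∈ C ↔ head e ∈ C) := by
        constructor
        · rintro ⟨-, a, ha, b, hb, hab⟩
          rcases Sym2.eq_iff.1 hab with ⟨rfl, rfl⟩ | ⟨rfl, rfl⟩ <;> tauto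
        · intro h
          by_cases ht : tail e ∈ C
          · exact ⟨heX, _, ht, _, fun hh => h (by tauto), rfl⟩
          · exact ⟨heX, _, by tauto, _, ht, Sym2.eq_swap⟩
      simp only [hin]
      by_cases ht : tail e ∈ C <;> by_cases hh : head e ∈ C
      · simp [ht, hh]
      -- An unsaturated edge leaving `C` would make its outer endpoint reachable.
      · have : f e = 1 := by
          by_contra hne
          exact hh (Relation.ReflTransGen.tail (hC ▸ ht : tail e ∈ {x | _})
            ⟨e, .inl ⟨⟨heX, hne⟩, rfl, rfl⟩⟩)
        simp [ht, hh, this]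
      · have : f e = -1 := by
          by_contra hne
          exact ht (Relation.ReflTransGen.tail (hC ▸ hh : head e ∈ {x | _})
            ⟨e, .inr ⟨⟨heX, hne⟩, rfl, rfl⟩⟩)
        simp [ht, hh, this]
      · simp [ht, hh]
    rw [hcard, Finset.sum_boole] at h
    rw [Set.ncard_eq_toFinset_card'] at hlt
    have : (Finset.univ.filter fun e => e ∈ X ∩ cut (fun e => s(tail e, head e)) C) =
        (X ∩ cut (fun e => s(tail e, head e)) C).toFinset := by ext; simp
    rw [this] at h
    omega

/-- Since the value is positive, following the flow from `u` must reach `v`. Subtracting that path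
clears its edges from the support, so the remaining paths avoid them. -/
lemma IsUnitFlow.hasEdgeDisjointPaths [Finite V] {ends : E → Sym2 V}
    (hends : ∀ e, ends e = s(tail e, head e)) {u v : V} (huv : u ≠ v) :
    ∀ {k : ℕ} {X : Set E} {f : E → ℤ}, IsUnitFlow tail head X u v k f →
      HasEdgeDisjointPaths ends X k u v
  | 0, _, _, _ => ⟨Fin.elim0, fun i => i.elim0, fun i => i.elim0⟩
  | k + 1, X, f, hf => by
    classical
    set P : E → ℤ → Prop := fun e s => f e = s with hP
    set C : Set V :=
      {x | Relation.ReflTransGen (fun x y => ∃ e, DirStep tail head P x e y) u x} with hC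
    have huC : u ∈ C := Relation.ReflTransGen.refl
    have hvC : v ∈ C := by
      by_contra hvC
      have h := hf.sum_cut huC hvC
      have hle : ∑ e, f e * ((if tail e ∈ C then 1 else 0) - (if head e ∈ C then 1 else 0)) ≤
          ∑ e : E, (0 : ℤ) := by
        refine Finset.sum_le_sum fun e _ => ?_
        have h3 := hf.range e
        by_cases ht : tail e ∈ C <;> by_cases hh : head e ∈ C
        · simp [ht, hh]
        · have : f e ≠ 1 := fun hne =>
            hh (Relation.ReflTransGen.tail ht ⟨e, .inl ⟨hne, rfl, rfl⟩⟩)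
          simp only [ht, hh, if_true, if_false]
          omega
        · have : f e ≠ -1 := fun hne =>
            ht (Relation.ReflTransGen.tail hh ⟨e, .inr ⟨hne, rfl, rfl⟩⟩)
          simp only [ht, hh, if_true, if_false]
          omega
        · simp [ht, hh]
      simp only [Finset.sum_const_zero] at hle
      push_cast at h
      omega
    obtain ⟨p, hp, hn⟩ := exists_stepWalk_nodup hvC
    obtain ⟨g, h0, h1, hg⟩ := exists_pathFlow hp hn
    have hpX : ∀ e ∈ p.map Prod.fst, e ∈ X := fun e he => by
      by_contra hX
      have h2 := h1 e he
      have h3 : f e = g e := h2.2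
      have h4 := hf.support e hX
      omega
    have hf' : IsUnitFlow tail head (X \ {e | e ∈ p.map Prod.fst}) u v k (f - g) := by
      refine ⟨fun e => ?_, fun e he => ?_, ?_, fun x hxu hxv => ?_⟩
      · by_cases he : e ∈ p.map Prod.fst
        · have h3 : f e = g e := (h1 e he).2
          simp [h3]
        · simpa [h0 e he] using hf.range e
      · by_cases hep : e ∈ p.map Prod.fst
        · have h3 : f e = g e := (h1 e hep).2
          simp [h3]
        · have : e ∉ X := fun h => he ⟨h, hep⟩
          simp [h0 e hep, hf.support e this]
      · rw [netOut_sub, hf.netOut_source, hg]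
        simp [huv.symm]
      · rw [netOut_sub, hf.netOut_eq_zero x hxu hxv, hg]
        simp [hxu.symm, hxv.symm]
    obtain ⟨Q, hQ, hd⟩ := IsUnitFlow.hasEdgeDisjointPaths hends huv hf'
    have hdis : ∀ i, (p.map Prod.fst).Disjoint ((Q i).map Prod.fst) :=
      fun i e he he' => ((hQ i).2 e he').2 he
    refine ⟨Fin.cons p Q, ?_, ?_⟩
    · refine Fin.cases ?_ fun i => ?_
      · exact ⟨⟨hp.isWalk fun _ _ _ h => h.ends_eq hends, hn⟩, hpX⟩
      · exact ⟨(hQ i).1, fun e he => ((hQ i).2 e he).1⟩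
    · intro i j
      induction i using Fin.cases with
      | zero =>
        induction j using Fin.cases with
        | zero => exact fun h => absurd rfl h
        | succ j => exact fun _ => hdis j
      | succ i =>
        induction j using Fin.cases with
        | zero => exact fun _ => (hdis i).symm
        | succ j => exact fun h => hd fun hij => h (congrArg Fin.succ hij)

end Flow

/-- **Menger's theorem** for edge-disjoint paths. -/
theorem hasEdgeDisjointPaths_of_le_cut {V E : Type*} [Finite V] [Finite E] {ends : E → Sym2 V}
    {X : Set E} {k : ℕ} {u v : V} (huv : u ≠ v)
    (hcut : ∀ C : Set V, u ∈ C → v ∉ C → k ≤ (X ∩ cut ends C).ncard) :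
    HasEdgeDisjointPaths ends X k u v := by
  have := Fintype.ofFinite E
  choose tail head hends using fun e => (Sym2.exists.1 ⟨ends e, rfl⟩ : ∃ a b, ends e = s(a, b))
  have hflow : ∀ j ≤ k, ∃ f, IsUnitFlow tail head X u v (j : ℕ) f := by
    intro j
    induction j with
    | zero =>
      exact fun _ => ⟨0, fun e => .inl rfl, fun e _ => rfl, by simp [netOut],
        fun x _ _ => by simp [netOut]⟩
    | succ j ih =>
      intro hj
      obtain ⟨f, hf⟩ := ih (by omega)
      refine hf.augment huv fun C hu hv => ?_
      have := hcut C hu hv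
      rw [show ends = fun e => s(tail e, head e) from funext hends] at this
      omega
  obtain ⟨f, hf⟩ := hflow k le_rfl
  exact hf.hasEdgeDisjointPaths hends huv



/-! ### Rooted binary Steiner trees and their decomposition into small pieces -/

/-- A rooted tree of links, in which branching is binary: a single vertex `v`; a tree hung by the
link `l` below a new root `u`; or two trees with a common root. -/
inductive SteinerTree (V L : Type*) where
  | leaf (v : V) : SteinerTree V L
  | edge (u : V) (l : L) (t : SteinerTree V L) : SteinerTree V L
  | join (a b : SteinerTree V L) : SteinerTree V L

namespace SteinerTree

variable {V L : Type*}

/-- The root of a tree. -/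
def root : SteinerTree V L → V
  | leaf v => v
  | edge u _ _ => u
  | join a _ => root a

/-- The leaves of a tree. -/
def leaves : SteinerTree V L → List V
  | leaf v => [v]
  | edge _ _ t => leaves t
  | join a b => leaves a ++ leaves b

/-- The links of a tree, with multiplicity. -/
def links : SteinerTree V L → List L
  | leaf _ => []
  | edge _ l t => l :: links t
  | join a b => links a ++ links b

/-- The total cost of the links of a tree. -/
def cost (w : L → ℝ) (t : SteinerTree V L) : ℝ := (t.links.map w).sum

/-- The path from the root to the first leaf. -/
def firstPath : SteinerTree V L → SteinerTree V L
  | leaf v => leaf v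
  | edge u l t => edge u l (firstPath t)
  | join a _ => firstPath a

/-- The leaves are ring nodes, all other vertices are not, and links join the vertices that they
should. -/
def Valid (I : Instance V L) : SteinerTree V L → Prop
  | leaf v => v ∈ I.ringNodes
  | edge u l t => u ∉ I.ringNodes ∧ I.ends l = s(u, t.root) ∧ Valid I t
  | join a b => a.root = b.root ∧ a.root ∉ I.ringNodes ∧ Valid I a ∧ Valid I b

/-- Cut a tree into pieces with at most `m + 1` levels of branching, the first cut being made
after `j` levels. Each piece is continued below a cut by a path to a leaf; these paths are disjoint
for distinct cuts. The first component of the result is the piece at the root. -/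
def split (m : ℕ) : ℕ → SteinerTree V L → SteinerTree V L × List (SteinerTree V L)
  | _, leaf v => (leaf v, [])
  | j, edge u l t => (edge u l (split m j t).1, (split m j t).2)
  | j + 1, join a b =>
    (join (split m j a).1 (split m j b).1, (split m j a).2 ++ (split m j b).2)
  | 0, join a b =>
    (b.firstPath,
      join (split m m a).1 (split m m b).1 :: ((split m m a).2 ++ (split m m b).2))

/-- The total cost of the pieces. -/
def splitCost (w : L → ℝ) (m j : ℕ) (t : SteinerTree V L) : ℝ :=
  (split m j t).1.cost w + ((split m j t).2.map (cost w)).sum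

lemma root_firstPath : ∀ t : SteinerTree V L, t.firstPath.root = t.root
  | leaf _ => rfl
  | edge _ _ _ => rfl
  | join a _ => root_firstPath a

lemma leaves_ne_nil : ∀ t : SteinerTree V L, t.leaves ≠ []
  | leaf _ => by simp [leaves]
  | edge _ _ t => leaves_ne_nil t
  | join a b => by simp [leaves, leaves_ne_nil a]

lemma length_leaves_firstPath : ∀ t : SteinerTree V L, t.firstPath.leaves.length = 1
  | leaf _ => rfl
  | edge _ _ t => length_leaves_firstPath t
  | join a _ => length_leaves_firstPath a

lemma leaves_firstPath_subset : ∀ t : SteinerTree V L, t.firstPath.leaves ⊆ t.leaves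
  | leaf _ => by simp [firstPath]
  | edge _ _ t => leaves_firstPath_subset t
  | join a _ => fun _ hx => List.mem_append_left _ (leaves_firstPath_subset a hx)

lemma Valid.firstPath {I : Instance V L} : ∀ {t : SteinerTree V L}, t.Valid I → t.firstPath.Valid I
  | leaf _, h => h
  | edge _ _ t, h => ⟨h.1, by rw [root_firstPath]; exact h.2.1, Valid.firstPath h.2.2⟩
  | join a _, h => Valid.firstPath (t := a) h.2.2.1

variable (m : ℕ)

lemma root_split : ∀ (j : ℕ) {I : Instance V L} {t : SteinerTree V L}, t.Valid I →
    (split m j t).1.root = t.root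
  | j, _, leaf _, _ => by simp [split]
  | j, _, edge _ _ _, _ => by simp [split, root]
  | 0, _, join a b, h => by simpa [split, root, root_firstPath] using h.1.symm
  | j + 1, _, join a b, h => by simpa [split, root] using root_split j h.2.2.1

lemma valid_split {I : Instance V L} : ∀ (j : ℕ) {t : SteinerTree V L}, t.Valid I →
    (split m j t).1.Valid I ∧ ∀ p ∈ (split m j t).2, p.Valid I
  | j, leaf _, h => by simpa [split] using h
  | j, edge _ _ t, h => by
    have ht := valid_split j h.2.2
    simp only [split]
    exact ⟨⟨h.1, by rw [root_split m j h.2.2]; exact h.2.1, ht.1⟩, ht.2⟩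
  | 0, join a b, h => by
    have ha := valid_split m h.2.2.1
    have hb := valid_split m h.2.2.2
    simp only [split, List.mem_cons, List.mem_append]
    refine ⟨h.2.2.2.firstPath, ?_⟩
    rintro p (rfl | hp | hp)
    · refine ⟨?_, ?_, ha.1, hb.1⟩
      · rw [root_split m m h.2.2.1, root_split m m h.2.2.2, h.1]
      · rw [root_split m m h.2.2.1]
        exact h.2.1
    · exact ha.2 p hp
    · exact hb.2 p hp
  | j + 1, join a b, h => by
    have ha := valid_split j h.2.2.1
    have hb := valid_split j h.2.2.2
    simp only [split, List.mem_append]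
    refine ⟨⟨?_, ?_, ha.1, hb.1⟩, ?_⟩
    · rw [root_split m j h.2.2.1, root_split m j h.2.2.2, h.1]
    · rw [root_split m j h.2.2.1]
      exact h.2.1
    · rintro p (hp | hp)
      · exact ha.2 p hp
      · exact hb.2 p hp

/-- Only `join` multiplies leaves. A piece begun at a cut has its own branching and `m` further
levels, hence the exponent `m + 1`; a path below a cut contributes one leaf. -/
lemma length_leaves_split : ∀ (j : ℕ) (t : SteinerTree V L),
    (split m j t).1.leaves.length ≤ 2 ^ j ∧ ∀ p ∈ (split m j t).2, p.leaves.length ≤ 2 ^ (m + 1)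
  | j, leaf _ => by simp [split, leaves, Nat.one_le_two_pow]
  | j, edge _ _ t => by simpa [split, leaves] using length_leaves_split j t
  | 0, join a b => by
    have ha := length_leaves_split m a
    have hb := length_leaves_split m b
    simp only [split, List.mem_cons, List.mem_append, length_leaves_firstPath]
    refine ⟨le_rfl, ?_⟩
    rintro p (rfl | hp | hp)
    · simp only [leaves, List.length_append, pow_succ]
      linarith [ha.1, hb.1]
    · exact ha.2 p hp
    · exact hb.2 p hp
  | j + 1, join a b => by
    have ha := length_leaves_split j a
    have hb := length_leaves_split j b
    simp only [split, List.mem_append]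
    refine ⟨?_, ?_⟩
    · simp only [leaves, List.length_append, pow_succ]
      linarith [ha.1, hb.1]
    · rintro p (hp | hp)
      · exact ha.2 p hp
      · exact hb.2 p hp

lemma leaves_split_subset : ∀ (j : ℕ) (t : SteinerTree V L), (split m j t).1.leaves ⊆ t.leaves
  | j, leaf _ => by simp [split]
  | j, edge _ _ t => by simpa [split, leaves] using leaves_split_subset j t
  | 0, join a b => by
    simp only [split, leaves]
    exact fun _ hx => List.mem_append_right _ (leaves_firstPath_subset b hx)
  | j + 1, join a b => by
    simp only [split, leaves]
    intro x hx
    rcases List.mem_append.1 hx with h | h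
    · exact List.mem_append_left _ (leaves_split_subset j a h)
    · exact List.mem_append_right _ (leaves_split_subset j b h)

/-- All leaves are on the same side of `C`. -/
def OneSided (C : Set V) (t : SteinerTree V L) : Prop :=
  ∀ x ∈ t.leaves, ∀ y ∈ t.leaves, x ∈ C → y ∈ C

/-- The piece `join a' b'` has a leaf in common with each of `a` and `b`, which ties the sides of
these two trees together. -/
lemma OneSided.join_of {C : Set V} {a b a' b' : SteinerTree V L} (h : (join a' b').OneSided C)
    (ha : a'.leaves ⊆ a.leaves) (hb : b'.leaves ⊆ b.leaves)
    (ha' : a'.OneSided C → a.OneSided C) (hb' : b'.OneSided C → b.OneSided C) :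
    (join a b).OneSided C := by
  have h1 := ha' fun x hx y hy => h x (List.mem_append_left _ hx) y (List.mem_append_left _ hy)
  have h2 := hb' fun x hx y hy => h x (List.mem_append_right _ hx) y (List.mem_append_right _ hy)
  obtain ⟨u, hu⟩ := List.exists_mem_of_ne_nil _ a'.leaves_ne_nil
  obtain ⟨v, hv⟩ := List.exists_mem_of_ne_nil _ b'.leaves_ne_nil
  have huv := h u (List.mem_append_left _ hu) v (List.mem_append_right _ hv)
  have hvu := h v (List.mem_append_right _ hv) u (List.mem_append_left _ hu)
  intro x hx y hy hxC
  rcases List.mem_append.1 hx with hx | hx <;> rcases List.mem_append.1 hy with hy | hy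
  · exact h1 x hx y hy hxC
  · exact h2 v (hb hv) y hy (huv (h1 x hx u (ha hu) hxC))
  · exact h1 u (ha hu) y hy (hvu (h2 x hx v (hb hv) hxC))
  · exact h2 x hx y hy hxC

lemma OneSided.of_split {C : Set V} : ∀ (j : ℕ) {t : SteinerTree V L},
    (∀ p ∈ (split m j t).2, p.OneSided C) → (split m j t).1.OneSided C → t.OneSided C
  | j, leaf _, _, h => by simpa [split] using h
  | j, edge _ _ t, hp, h => by
    simp only [split] at hp h
    exact OneSided.of_split j (t := t) hp h
  | 0, join a b, hp, _ => by
    simp only [split, List.mem_cons, List.mem_append] at hp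
    -- At a cut, the new piece alone links `a` to `b`; the path left above the cut is not needed
    -- here.
    exact (hp _ (.inl rfl)).join_of (leaves_split_subset m m a) (leaves_split_subset m m b)
      (OneSided.of_split m (t := a) fun p h => hp p (.inr (.inl h)))
      (OneSided.of_split m (t := b) fun p h => hp p (.inr (.inr h)))
  | j + 1, join a b, hp, h => by
    simp only [split, List.mem_append] at hp h
    exact h.join_of (leaves_split_subset m j a) (leaves_split_subset m j b)
      (OneSided.of_split j (t := a) fun p h => hp p (.inl h))
      (OneSided.of_split j (t := b) fun p h => hp p (.inr h))

variable (w : L → ℝ)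

/-- Each offset pays for the tree once, plus the paths added at its cuts. A given `join a b` is cut
for exactly one of the `m + 1` offsets, which adds the first path of `b`. As first paths continue
into `a`, these paths together with the first path from the root partition the links, giving one
further copy of the tree. -/
lemma sum_splitCost : ∀ t : SteinerTree V L,
    ∑ j ∈ Finset.range (m + 1), splitCost w m j t + t.firstPath.cost w =
      ((m + 1 : ℕ) + 1) * t.cost w
  | leaf _ => by simp [splitCost, split, cost, firstPath, links]
  | edge u l t => by
    have ih := sum_splitCost t
    have h : ∀ j, splitCost w m j (edge u l t) = w l + splitCost w m j t := fun j => by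
      simp [splitCost, split, cost, links, add_assoc]
    simp only [h, Finset.sum_add_distrib, Finset.sum_const, Finset.card_range, nsmul_eq_mul]
    have h1 : (edge u l t).cost w = w l + t.cost w := by simp [cost, links]
    have h2 : (edge u l t).firstPath.cost w = w l + t.firstPath.cost w := by
      simp [cost, links, firstPath]
    rw [h1, h2]
    linear_combination ih
  | join a b => by
    have iha := sum_splitCost a
    have ihb := sum_splitCost b
    have h0 : splitCost w m 0 (join a b) =
        b.firstPath.cost w + splitCost w m m a + splitCost w m m b := by
      simp only [splitCost, split, cost, links, List.map_cons, List.sum_cons, List.map_append,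
        List.sum_append]
      ring
    have h : ∀ j, splitCost w m (j + 1) (join a b) = splitCost w m j a + splitCost w m j b :=
      fun j => by
        simp only [splitCost, split, cost, links, List.map_append, List.sum_append]
        ring
    have h1 : (join a b).cost w = a.cost w + b.cost w := by simp [cost, links]
    have h2 : (join a b).firstPath = a.firstPath := rfl
    rw [Finset.sum_range_succ] at iha ihb
    rw [Finset.sum_range_succ', h0, h1, h2]
    simp only [h, Finset.sum_add_distrib]
    linear_combination iha + ihb

lemma cost_nonneg {w : L → ℝ} (hw : ∀ l, 0 ≤ w l) (t : SteinerTree V L) : 0 ≤ t.cost w :=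
  List.sum_nonneg fun x hx => by
    obtain ⟨l, _, rfl⟩ := List.mem_map.1 hx
    exact hw l

/-- A tree can be replaced by pieces with at most `2 ^ k` leaves at `1 + 1 / k` times the cost. -/
lemma exists_pieces {I : Instance V L} {w : L → ℝ} (hw : ∀ l, 0 ≤ w l) {k : ℕ} (hk : 0 < k)
    {t : SteinerTree V L} (ht : t.Valid I) :
    ∃ P : List (SteinerTree V L), (∀ p ∈ P, p.Valid I ∧ p.leaves.length ≤ 2 ^ k) ∧
      (P.map (cost w)).sum ≤ (1 + 1 / k) * t.cost w ∧
      ∀ C : Set V, (∀ p ∈ P, p.OneSided C) → t.OneSided C := by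
  obtain ⟨m, rfl⟩ : ∃ m, k = m + 1 := ⟨k - 1, by omega⟩
  have hsum := sum_splitCost m w t
  have h0 := cost_nonneg hw t.firstPath
  have hm : (0 : ℝ) < (m + 1 : ℕ) := by positivity
  obtain ⟨j, hj, hle⟩ : ∃ j ∈ Finset.range (m + 1),
      splitCost w m j t ≤ (1 + 1 / (m + 1 : ℕ)) * t.cost w := by
    -- Averaging over the `m + 1` offsets.
    apply Finset.exists_le_of_sum_le (by simp)
    rw [Finset.sum_const, Finset.card_range, nsmul_eq_mul]
    have : ((m + 1 : ℕ) : ℝ) * ((1 + 1 / (m + 1 : ℕ)) * t.cost w) =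
        ((m + 1 : ℕ) + 1) * t.cost w := by
      field_simp
    linarith
  have hj' : j ≤ m + 1 := by
    have := Finset.mem_range.1 hj
    omega
  have hv := valid_split m j ht
  have hl := length_leaves_split m j t
  refine ⟨(split m j t).1 :: (split m j t).2, ?_, ?_, fun C hC => ?_⟩
  · intro p hp
    rcases List.mem_cons.1 hp with rfl | hp
    · exact ⟨hv.1, hl.1.trans (Nat.pow_le_pow_right (by norm_num) hj')⟩
    · exact ⟨hv.2 p hp, hl.2 p hp⟩
  · simpa [splitCost] using hle
  · exact OneSided.of_split m j (fun p hp => hC p (List.mem_cons_of_mem _ hp))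
      (hC _ List.mem_cons_self)

end SteinerTree



/-! ### Full components inside a set of links -/

namespace Instance

variable {V L : Type*} (I : Instance V L)

/-- One can reach `v` from `r` by links of `A`, meeting no ring node after `r`. -/
def Reach (A : Finset L) (r v : V) : Prop :=
  Relation.ReflTransGen (fun x y => y ∉ I.ringNodes ∧ ∃ l ∈ A, I.ends l = s(x, y)) r v

/-- A link of `A` joins `t` to a vertex that can be reached from `r`. -/
def Attached (A : Finset L) (r t : V) : Prop :=
  ∃ v, I.Reach A r v ∧ ∃ l ∈ A, I.ends l = s(v, t)

/-- All of `T` is attached to what can be reached from one vertex outside the ring. -/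
def Spans (T : Set V) (A : Finset L) : Prop :=
  ∃ r ∉ I.ringNodes, ∀ t ∈ T, I.Attached A r t

variable {I} {A B : Finset L} {r v t x y : V} {l : L}

lemma Reach.step (h : I.Reach A r x) (hy : y ∉ I.ringNodes) (hl : l ∈ A)
    (hxy : I.ends l = s(x, y)) : I.Reach A r y :=
  Relation.ReflTransGen.tail h ⟨hy, l, hl, hxy⟩

lemma Reach.mono (hAB : A ⊆ B) (h : I.Reach A r v) : I.Reach B r v :=
  Relation.ReflTransGen.mono (fun _ _ ⟨hy, l, hl, he⟩ => ⟨hy, l, hAB hl, he⟩) _ _ h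

lemma Reach.notMem_ringNodes (hr : r ∉ I.ringNodes) (h : I.Reach A r v) : v ∉ I.ringNodes := by
  rcases Relation.ReflTransGen.cases_tail h with rfl | ⟨_, _, h, _⟩
  exacts [hr, h]

lemma Reach.symm (hr : r ∉ I.ringNodes) (h : I.Reach A r v) : I.Reach A v r := by
  induction h with
  | refl => exact Relation.ReflTransGen.refl
  | tail hab hbc ih =>
    obtain ⟨_, l, hl, he⟩ := hbc
    exact Relation.ReflTransGen.head
      ⟨Reach.notMem_ringNodes hr hab, l, hl, he.trans Sym2.eq_swap⟩ ih

lemma Attached.mono (hAB : A ⊆ B) : I.Attached A r t → I.Attached B r t :=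
  fun ⟨v, hv, l, hl, he⟩ => ⟨v, hv.mono hAB, l, hAB hl, he⟩

lemma Attached.of_reach (hvr : I.Reach A v r) : I.Attached A r t → I.Attached A v t :=
  fun ⟨x, hx, h⟩ => ⟨x, Relation.ReflTransGen.trans hvr hx, h⟩

open scoped Classical in
lemma Reach.erase
    (h : ∀ x y, I.ends l = s(x, y) → I.Reach (A.erase l) r x → y ∉ I.ringNodes →
      I.Reach (A.erase l) r y) (hv : I.Reach A r v) : I.Reach (A.erase l) r v := by
  induction hv with
  | refl => exact Relation.ReflTransGen.refl
  | tail hab hbc ih =>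
    obtain ⟨hc, l', hl', he⟩ := hbc
    by_cases hll : l' = l
    · subst hll
      exact h _ _ he ih hc
    · exact ih.step hc (Finset.mem_erase.2 ⟨hll, hl'⟩) he

/-! ### Minimal spanning link sets are trees with the prescribed leaves. -/

section Minimal

variable {T : Set V} {K : Finset L}

open scoped Classical in
/-- No link of a minimal spanning set can be bypassed. -/
lemma false_of_bypass (hK : Minimal (I.Spans T) K) (hr : r ∉ I.ringNodes)
    (hT : ∀ t ∈ T, I.Attached K r t) (hl : l ∈ K)
    (h : ∀ x y, I.ends l = s(x, y) → I.Reach (K.erase l) r x → y ∉ I.ringNodes →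
      I.Reach (K.erase l) r y)
    (h' : ∀ x t, I.ends l = s(x, t) → I.Reach (K.erase l) r x → t ∈ T →
      I.Attached (K.erase l) r t) : False := by
  refine hK.not_prop_of_lt (Finset.erase_ssubset hl) ⟨r, hr, fun t ht => ?_⟩
  obtain ⟨v, hv, l', hl', he⟩ := hT t ht
  have hv' := hv.erase h
  by_cases hll : l' = l
  · subst hll
    exact h' _ _ he hv' ht
  · exact ⟨v, hv', l', Finset.mem_erase.2 ⟨hll, hl'⟩, he⟩

lemma exists_reach_mem_ends (hK : Minimal (I.Spans T) K) (hr : r ∉ I.ringNodes)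
    (hT : ∀ t ∈ T, I.Attached K r t) (hl : l ∈ K) : ∃ x y, I.Reach K r x ∧ I.ends l = s(x, y) := by
  classical
  by_contra! hcon
  exact false_of_bypass hK hr hT hl
    (fun x y he hx => absurd he (hcon x y (hx.mono (Finset.erase_subset _ _))))
    (fun x y he hx => absurd he (hcon x y (hx.mono (Finset.erase_subset _ _))))

lemma reach_of_mem_verts (hK : Minimal (I.Spans T) K) (hr : r ∉ I.ringNodes)
    (hT : ∀ t ∈ T, I.Attached K r t) (hv : v ∈ verts I.ends (K : Set L))
    (hvr : v ∉ I.ringNodes) : I.Reach K r v := by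
  obtain ⟨l, hl, hvl⟩ := hv
  obtain ⟨x, y, hx, he⟩ := exists_reach_mem_ends hK hr hT hl
  rw [he] at hvl
  rcases Sym2.mem_iff.1 hvl with rfl | rfl
  exacts [hx, hx.step hvr hl he]

/-- Reachability never passes through a ring node, so a link at `t` serves only to attach `t`. It is
superfluous if `t` need not be attached, or if another link does so. -/
lemma mem_and_unique_of_mem_ends (hK : Minimal (I.Spans T) K)
    (hr : r ∉ I.ringNodes) (hT : ∀ t ∈ T, I.Attached K r t) (hl : l ∈ K)
    (ht : t ∈ I.ringNodes) (htl : t ∈ I.ends l) :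
    t ∈ T ∧ ∀ l' ∈ K, t ∈ I.ends l' → l' = l := by
  classical
  have hx : ∀ l' ∈ K, t ∈ I.ends l' → ∃ x, I.Reach K r x ∧ I.ends l' = s(x, t) := by
    intro l' hl' htl'
    obtain ⟨x, y, hx, he⟩ := exists_reach_mem_ends hK hr hT hl'
    rw [he] at htl'
    rcases Sym2.mem_iff.1 htl' with rfl | rfl
    · exact absurd ht (hx.notMem_ringNodes hr)
    · exact ⟨x, hx, he⟩
  have hstep : ∀ x y, I.ends l = s(x, y) → I.Reach (K.erase l) r x → y = t := by
    intro x y he hx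
    rw [he] at htl
    rcases Sym2.mem_iff.1 htl with rfl | rfl
    · exact absurd ht (hx.notMem_ringNodes hr)
    · rfl
  have h1 : ∀ x y, I.ends l = s(x, y) → I.Reach (K.erase l) r x → y ∉ I.ringNodes →
      I.Reach (K.erase l) r y := fun x y he hx hy => absurd (hstep x y he hx ▸ ht) hy
  constructor
  · by_contra htT
    exact false_of_bypass hK hr hT hl h1 fun x y he hx hy => absurd (hstep x y he hx ▸ hy) htT
  · intro l' hl' htl'
    by_contra hll
    refine false_of_bypass hK hr hT hl h1 fun x y he hx hy => ?_
    obtain rfl := hstep x y he hx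
    obtain ⟨z, hz, hez⟩ := hx l' hl' htl'
    exact ⟨z, hz.erase h1, l', Finset.mem_erase.2 ⟨hll, hl'⟩, hez⟩

lemma not_isDiag_of_minimal (hTR : T ⊆ I.ringNodes) (hK : Minimal (I.Spans T) K)
    (hr : r ∉ I.ringNodes) (hT : ∀ t ∈ T, I.Attached K r t) (hl : l ∈ K) :
    ¬ (I.ends l).IsDiag := by
  classical
  intro hd
  have hxy : ∀ x y, I.ends l = s(x, y) → x = y := fun x y he => by
    rw [he] at hd
    exact hd
  exact false_of_bypass hK hr hT hl (fun x y he hx _ => hxy x y he ▸ hx)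
    fun x y he hx hy => absurd (hTR (hxy x y he ▸ hy)) (hx.notMem_ringNodes hr)

lemma injOn_ends_of_minimal (hK : Minimal (I.Spans T) K)
    (hr : r ∉ I.ringNodes) (hT : ∀ t ∈ T, I.Attached K r t) : Set.InjOn I.ends (K : Set L) := by
  classical
  intro l hl l' hl' hll
  by_contra hne
  have hl'' : l' ∈ K.erase l := Finset.mem_erase.2 ⟨fun h => hne h.symm, hl'⟩
  exact false_of_bypass hK hr hT hl
    (fun x y he hx hy => hx.step hy hl'' (hll ▸ he))
    fun x y he hx hy => ⟨x, hx, l', hl'', hll ▸ he⟩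

/-- Every link is a bridge: a link at a ring node is the only one there, and any other link that is
not a bridge can be bypassed outside the ring. -/
lemma isAcyclic_of_minimal (hTR : T ⊆ I.ringNodes) (hK : Minimal (I.Spans T) K)
    (hr : r ∉ I.ringNodes) (hT : ∀ t ∈ T, I.Attached K r t) :
    (SimpleGraph.fromEdgeSet (I.ends '' (K : Set L))).IsAcyclic := by
  classical
  have key : ∀ l ∈ K, ∀ u v, I.ends l = s(u, v) → ∀ X : Set V, u ∈ X →
      (∀ x ∈ X, ∀ y, ∀ l' ∈ K.erase l, I.ends l' = s(x, y) → y ∈ X) →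
      ((SimpleGraph.fromEdgeSet (I.ends '' (K : Set L))).deleteEdges {s(u, v)}).Reachable u v →
      v ∈ X := by
    intro l hl u v he X hu hX ⟨p⟩
    clear hT hr
    have hmem : ∀ {a b : V} (p : ((SimpleGraph.fromEdgeSet (I.ends '' (K : Set L))).deleteEdges
        {s(u, v)}).Walk a b), a ∈ X → b ∈ X := by
      intro a b p
      induction p with
      | nil => exact id
      | cons h _ ih =>
        intro ha
        rw [SimpleGraph.deleteEdges_adj, SimpleGraph.fromEdgeSet_adj] at h
        obtain ⟨⟨⟨l', hl', he'⟩, _⟩, hne⟩ := h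
        refine ih (hX _ ha _ l' (Finset.mem_erase.2 ⟨?_, hl'⟩) he')
        rintro rfl
        exact hne (by rw [← he', ← he]; rfl)
    exact hmem p hu
  have ring_case : ∀ l ∈ K, ∀ u v, I.ends l = s(u, v) → u ∈ I.ringNodes →
      ¬ ((SimpleGraph.fromEdgeSet (I.ends '' (K : Set L))).deleteEdges {s(u, v)}).Reachable u v := by
    intro l hl u v he hu hreach
    have huniq := (mem_and_unique_of_mem_ends hK hr hT hl hu (by rw [he]; simp)).2
    have hv : v ∈ ({u} : Set V) := by
      refine key l hl u v he _ rfl (fun x hx y l' hl' he' => ?_) hreach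
      obtain rfl : x = u := hx
      obtain ⟨h1, h2⟩ := Finset.mem_erase.1 hl'
      exact absurd (huniq l' h2 (by rw [he']; simp)) h1
    obtain rfl : v = u := hv
    exact not_isDiag_of_minimal hTR hK hr hT hl (by rw [he]; rfl)
  rw [SimpleGraph.isAcyclic_iff_forall_isBridge]
  intro e
  induction e with | h u v => ?_
  intro hadj
  obtain ⟨⟨l, hl, he⟩, -⟩ := (SimpleGraph.fromEdgeSet_adj _).1 hadj
  rw [SimpleGraph.isBridge_iff]
  intro hreach
  by_cases hu : u ∈ I.ringNodes
  · exact ring_case l hl u v he hu hreach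
  by_cases hv : v ∈ I.ringNodes
  · refine ring_case l hl v u (he.trans Sym2.eq_swap) hv ?_
    rw [Sym2.eq_swap]
    exact hreach.symm
  -- Ring nodes are dead ends in `K`, so this set is closed under the remaining links.
  have hX : v ∈ {x | I.Reach (K.erase l) u x ∨ (x ∈ I.ringNodes ∧ I.Attached (K.erase l) u x)} := by
    refine key l hl u v he _ (.inl Relation.ReflTransGen.refl) ?_ hreach
    rintro x (hx | ⟨hxR, z, hz, l'', hl'', he''⟩) y l' hl' he'
    · by_cases hy : y ∈ I.ringNodes
      · exact .inr ⟨hy, x, hx, l', hl', he'⟩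
      · exact .inl (hx.step hy hl' he')
    · have h1 := (mem_and_unique_of_mem_ends hK hr hT (Finset.mem_of_mem_erase hl'') hxR
        (by rw [he'']; simp)).2 l' (Finset.mem_of_mem_erase hl') (by rw [he']; simp)
      subst h1
      rw [he''] at he'
      rcases Sym2.eq_iff.1 he' with ⟨rfl, rfl⟩ | ⟨rfl, _⟩
      · exact .inl hz
      · exact .inl hz
  have huv : I.Reach (K.erase l) u v := hX.resolve_right fun h => hv h.1
  refine false_of_bypass hK hr hT hl (fun x y he' hx _ => ?_) fun x y he' _ hy => ?_
  · rw [he] at he'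
    rcases Sym2.eq_iff.1 he' with ⟨rfl, rfl⟩ | ⟨rfl, rfl⟩
    · exact Relation.ReflTransGen.trans hx huv
    · exact Relation.ReflTransGen.trans hx (huv.symm hu)
  · rw [he] at he'
    rcases Sym2.eq_iff.1 he' with ⟨rfl, rfl⟩ | ⟨rfl, rfl⟩
    · exact absurd (hTR hy) hv
    · exact absurd (hTR hy) hu

lemma isEdgeTree_of_minimal (hTR : T ⊆ I.ringNodes) (hT0 : T.Nonempty)
    (hK : Minimal (I.Spans T) K) (hr : r ∉ I.ringNodes) (hT : ∀ t ∈ T, I.Attached K r t) :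
    IsEdgeTree I.ends (K : Set L) := by
  have hverts : ∀ {l x y}, l ∈ K → I.ends l = s(x, y) →
      x ∈ verts I.ends (K : Set L) ∧ y ∈ verts I.ends (K : Set L) :=
    fun {l x y} hl he => ⟨⟨l, hl, by rw [he]; simp⟩, ⟨l, hl, by rw [he]; simp⟩⟩
  obtain ⟨t, ht⟩ := hT0
  obtain ⟨z, hz, l₀, hl₀, he₀⟩ := hT t ht
  have hrv : r ∈ verts I.ends (K : Set L) := by
    rcases Relation.ReflTransGen.cases_head hz with rfl | ⟨_, ⟨_, l, hl, he⟩, _⟩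
    exacts [(hverts hl₀ he₀).1, (hverts hl he).1]
  have hadj : ∀ {l x y} (hl : l ∈ K) (he : I.ends l = s(x, y)),
      ((SimpleGraph.fromEdgeSet (I.ends '' (K : Set L))).induce (verts I.ends (K : Set L))).Adj
        ⟨x, (hverts hl he).1⟩ ⟨y, (hverts hl he).2⟩ := fun {l x y} hl he => by
    rw [SimpleGraph.comap_adj, SimpleGraph.fromEdgeSet_adj]
    refine ⟨⟨l, hl, he⟩, fun hxy => not_isDiag_of_minimal hTR hK hr hT hl ?_⟩
    rw [he]
    exact hxy
  have hreach : ∀ {v} (_ : I.Reach K r v), ∃ hv : v ∈ verts I.ends (K : Set L),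
      ((SimpleGraph.fromEdgeSet (I.ends '' (K : Set L))).induce
        (verts I.ends (K : Set L))).Reachable ⟨r, hrv⟩ ⟨v, hv⟩ := fun {v} h => by
    induction h with
    | refl => exact ⟨hrv, SimpleGraph.Reachable.refl _⟩
    | tail _ hbc ih =>
      obtain ⟨_, l, hl, he⟩ := hbc
      obtain ⟨_, hb⟩ := ih
      exact ⟨(hverts hl he).2, hb.trans (hadj hl he).reachable⟩
  refine ⟨⟨l₀, hl₀⟩, fun l hl => not_isDiag_of_minimal hTR hK hr hT hl,
    injOn_ends_of_minimal hK hr hT, ⟨?_, (isAcyclic_of_minimal hTR hK hr hT).induce _⟩⟩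
  rw [SimpleGraph.connected_iff_exists_forall_reachable]
  refine ⟨⟨r, hrv⟩, ?_⟩
  rintro ⟨v, l, hl, hvl⟩
  obtain ⟨x, y, hx, he⟩ := exists_reach_mem_ends hK hr hT hl
  obtain ⟨_, h⟩ := hreach hx
  have hvl' := hvl
  rw [he] at hvl'
  rcases Sym2.mem_iff.1 hvl' with rfl | rfl
  exacts [h, h.trans (hadj hl he).reachable]

/-- If `r` had a single link, to `w`, then `w` could be the root without that link, unless `w` is a
ring node; in that case only `w` is attached, too little for a nontrivial `T`. -/
lemma degree_ne_one_of_minimal (hTR : T ⊆ I.ringNodes) (hT2 : T.Nontrivial)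
    (hK : Minimal (I.Spans T) K) (hr : r ∉ I.ringNodes) (hT : ∀ t ∈ T, I.Attached K r t) :
    degree I.ends (K : Set L) r ≠ 1 := by
  classical
  intro hdeg
  obtain ⟨l, hl⟩ := Set.ncard_eq_one.1 hdeg
  have hlK : l ∈ K ∧ r ∈ I.ends l := by
    have : l ∈ {e ∈ (K : Set L) | r ∈ I.ends e} := by rw [hl]; rfl
    exact this
  have huniq : ∀ l' ∈ K, r ∈ I.ends l' → l' = l := fun l' h1 h2 => by
    have : l' ∈ {e ∈ (K : Set L) | r ∈ I.ends e} := ⟨h1, h2⟩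
    rwa [hl] at this
  obtain ⟨w, he⟩ := Sym2.mem_iff_exists.1 hlK.2
  have hstep : ∀ l' ∈ K, ∀ y, I.ends l' = s(r, y) → y = w := fun l' hl' y he' => by
    obtain rfl := huniq l' hl' (by rw [he']; simp)
    rw [he] at he'
    exact (Sym2.congr_right.1 he').symm
  by_cases hw : w ∈ I.ringNodes
  · obtain ⟨t, ht, htw⟩ := hT2.exists_ne w
    obtain ⟨z, hz, l', hl', he'⟩ := hT t ht
    rcases Relation.ReflTransGen.cases_head hz with rfl | ⟨y, ⟨hy, l'', hl'', he''⟩, _⟩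
    · exact htw (hstep l' hl' t he')
    · exact hy (hstep l'' hl'' y he'' ▸ hw)
  have hreach : ∀ z, I.Reach K r z → z = r ∨ I.Reach (K.erase l) w z := by
    intro z hz
    induction hz with
    | refl => exact .inl rfl
    | @tail b c _ hbc ih =>
      obtain ⟨hc, l', hl', he'⟩ := hbc
      rcases ih with rfl | ih
      · obtain rfl := hstep l' hl' c he'
        exact .inr Relation.ReflTransGen.refl
      by_cases hll : l' = l
      · subst hll
        rw [he] at he'
        rcases Sym2.eq_iff.1 he' with ⟨_, rfl⟩ | ⟨rfl, _⟩
        · exact .inr Relation.ReflTransGen.refl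
        · exact .inl rfl
      · exact .inr (ih.step hc (Finset.mem_erase.2 ⟨hll, hl'⟩) he')
  refine hK.not_prop_of_lt (Finset.erase_ssubset hlK.1) ⟨w, hw, fun t ht => ?_⟩
  obtain ⟨z, hz, l', hl', he'⟩ := hT t ht
  rcases hreach z hz with rfl | hz'
  · exact absurd (hTR (hstep l' hl' t he' ▸ ht)) hw
  · refine ⟨z, hz', l', Finset.mem_erase.2 ⟨?_, hl'⟩, he'⟩
    rintro rfl
    rw [he] at he'
    rcases Sym2.eq_iff.1 he' with ⟨_, rfl⟩ | ⟨rfl, _⟩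
    · exact hw (hTR ht)
    · exact hr (hTR ht)

end Minimal

lemma Spans.exists_isFullComponent {T : Set V} (hTR : T ⊆ I.ringNodes) (hT2 : T.Nontrivial)
    (h : I.Spans T A) : ∃ K ⊆ A, I.IsFullComponent (K : Set L) ∧ I.joined (K : Set L) = T := by
  obtain ⟨K, hKA, hK⟩ := exists_minimal_le_of_wellFoundedLT _ A h
  obtain ⟨r, hr, hT⟩ := hK.prop
  refine ⟨K, hKA, ⟨isEdgeTree_of_minimal hTR hT2.nonempty hK hr hT, fun v hv => ⟨fun hvR => ?_,
    fun hdeg => ?_⟩⟩, Set.ext fun v => ⟨?_, fun hv => ⟨?_, hTR hv⟩⟩⟩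
  · obtain ⟨l, hl, hvl⟩ := hv
    have := (mem_and_unique_of_mem_ends hK hr hT hl hvR hvl).2
    rw [degree, Set.ncard_eq_one]
    exact ⟨l, Set.ext fun l' => ⟨fun h => this l' h.1 h.2, by rintro rfl; exact ⟨hl, hvl⟩⟩⟩
  -- Any non-ring vertex of `K` can take the role of the root, so the degree bound applies to it.
  · by_contra hvR
    have hrv := reach_of_mem_verts hK hr hT hv hvR
    exact degree_ne_one_of_minimal hTR hT2 hK hvR
      (fun t ht => (hT t ht).of_reach (hrv.symm hr)) hdeg
  · rintro ⟨⟨l, hl, hvl⟩, hvR⟩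
    exact (mem_and_unique_of_mem_ends hK hr hT hl hvR hvl).1
  · obtain ⟨z, _, l, hl, he⟩ := hT v hv
    exact ⟨l, hl, by rw [he]; simp⟩

end Instance



/-! ### Small full components that connect as much as a given set of links -/

namespace SteinerTree

variable {V L : Type*} {I : Instance V L}

lemma Valid.mem_ringNodes : ∀ {t : SteinerTree V L}, t.Valid I → ∀ x ∈ t.leaves, x ∈ I.ringNodes
  | leaf v, h, x, hx => by
    obtain rfl : x = v := by simpa [leaves] using hx
    exact h
  | edge _ _ t, h, x, hx => Valid.mem_ringNodes (t := t) h.2.2 x hx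
  | join a b, h, x, hx => by
    rcases List.mem_append.1 hx with hx | hx
    · exact Valid.mem_ringNodes (t := a) h.2.2.1 x hx
    · exact Valid.mem_ringNodes (t := b) h.2.2.2 x hx

lemma Valid.eq_root : ∀ {t : SteinerTree V L}, t.Valid I → t.root ∈ I.ringNodes →
    ∀ x ∈ t.leaves, x = t.root
  | leaf _, _, _, x, hx => by simpa [leaves, root] using hx
  | edge _ _ _, h, hr, _, _ => absurd hr h.1
  | join _ _, h, hr, _, _ => absurd hr h.2.1

lemma Valid.attached {A : Finset L} : ∀ {t : SteinerTree V L}, t.Valid I →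
    t.root ∉ I.ringNodes → (∀ l ∈ t.links, l ∈ A) → ∀ x ∈ t.leaves, I.Attached A t.root x
  | leaf _, h, hr, _, _, _ => absurd h hr
  | edge u l t, h, _, hA, x, hx => by
    have hl := hA l (by simp [links])
    by_cases ht : t.root ∈ I.ringNodes
    · obtain rfl := Valid.eq_root (t := t) h.2.2 ht x hx
      exact ⟨u, Relation.ReflTransGen.refl, l, hl, h.2.1⟩
    · exact (Valid.attached (t := t) h.2.2 ht (fun l' hl' => hA l' (by simp [links, hl'])) x
        hx).of_reach (Relation.ReflTransGen.single ⟨ht, l, hl, h.2.1⟩)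
  | join a b, h, hr, hA, x, hx => by
    rcases List.mem_append.1 hx with hx | hx
    · exact Valid.attached (t := a) h.2.2.1 h.2.1 (fun l' hl' => hA l' (by simp [links, hl'])) x hx
    · have := Valid.attached (t := b) h.2.2.2 (h.1 ▸ h.2.1)
        (fun l' hl' => hA l' (by simp [links, hl'])) x hx
      rwa [← h.1] at this

open scoped Classical in
lemma sum_toFinset_links_le {w : L → ℝ} (hw : ∀ l, 0 ≤ w l) (t : SteinerTree V L) :
    ∑ l ∈ t.links.toFinset, w l ≤ t.cost w := by
  rw [cost, Finset.sum_list_map_count]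
  refine Finset.sum_le_sum fun l hl => ?_
  have : 1 ≤ t.links.count l := List.one_le_count_iff.2 (List.mem_toFinset.1 hl)
  rw [nsmul_eq_mul]
  exact le_mul_of_one_le_left (hw l) (by exact_mod_cast this)

lemma Valid.exists_isFullComponent {t : SteinerTree V L} (h : t.Valid I)
    (h2 : {x | x ∈ t.leaves}.Nontrivial) :
    ∃ K : Finset L, I.IsFullComponent (K : Set L) ∧ I.joined (K : Set L) = {x | x ∈ t.leaves} ∧
      I.linkCost K ≤ t.cost I.cost := by
  classical
  have hr : t.root ∉ I.ringNodes := fun hr => by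
    obtain ⟨x, hx, y, hy, hxy⟩ := h2
    exact hxy ((h.eq_root hr x hx).trans (h.eq_root hr y hy).symm)
  have hs : I.Spans {x | x ∈ t.leaves} t.links.toFinset :=
    ⟨t.root, hr, h.attached hr fun l hl => List.mem_toFinset.2 hl⟩
  obtain ⟨K, hK, hfull, hj⟩ := hs.exists_isFullComponent h.mem_ringNodes h2
  exact ⟨K, hfull, hj, (Finset.sum_le_sum_of_subset_of_nonneg hK
    fun l _ _ => I.cost_nonneg l).trans (sum_toFinset_links_le I.cost_nonneg t)⟩

end SteinerTree

namespace Instance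

variable {V L : Type*} {I : Instance V L}

lemma linkCost_nonneg (K : Finset L) : 0 ≤ I.linkCost K :=
  Finset.sum_nonneg fun l _ => I.cost_nonneg l

lemma linkCost_mono {A B : Finset L} (h : A ⊆ B) : I.linkCost A ≤ I.linkCost B :=
  Finset.sum_le_sum_of_subset_of_nonneg h fun l _ _ => I.cost_nonneg l

open scoped Classical in
lemma componentsCost_union_le (F G : Finset (Finset L)) :
    I.componentsCost (F ∪ G) ≤ I.componentsCost F + I.componentsCost G := by
  have h := Finset.sum_union_inter (s₁ := F) (s₂ := G) (f := I.linkCost)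
  have h0 : 0 ≤ ∑ K ∈ F ∩ G, I.linkCost K := Finset.sum_nonneg fun K _ => linkCost_nonneg K
  simp only [componentsCost]
  linarith

/-- A collection of full components that join at most `γ` ring nodes each. -/
def IsSmall (I : Instance V L) (γ : ℕ) (F : Finset (Finset L)) : Prop :=
  ∀ K ∈ F, I.IsFullComponent (K : Set L) ∧ (I.joined (K : Set L)).ncard ≤ γ

open scoped Classical in
lemma IsSmall.union {γ : ℕ} {F G : Finset (Finset L)} (hF : I.IsSmall γ F) (hG : I.IsSmall γ G) :
    I.IsSmall γ (F ∪ G) := fun K hK => (Finset.mem_union.1 hK).elim (hF K) (hG K)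

lemma exists_isSmall_of_pieces {γ : ℕ} (P : List (SteinerTree V L))
    (hP : ∀ p ∈ P, p.Valid I ∧ p.leaves.length ≤ γ) :
    ∃ F, I.IsSmall γ F ∧ I.componentsCost F ≤ (P.map (SteinerTree.cost I.cost)).sum ∧
      ∀ C : Set V, ∀ p ∈ P, ¬ p.OneSided C → ∃ K ∈ F, I.Covers (K : Set L) C := by
  classical
  induction P with
  | nil => exact ⟨∅, by simp [IsSmall], by simp [componentsCost], by simp⟩
  | cons p P ih =>
    obtain ⟨F, hF, hcost, hcov⟩ := ih fun q hq => hP q (List.mem_cons_of_mem _ hq)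
    obtain ⟨hv, hlen⟩ := hP p List.mem_cons_self
    by_cases h2 : {x | x ∈ p.leaves}.Nontrivial
    · obtain ⟨K, hfull, hj, hle⟩ := hv.exists_isFullComponent h2
      have hset : {x | x ∈ p.leaves} = (p.leaves.toFinset : Set V) := by ext; simp
      refine ⟨{K} ∪ F, IsSmall.union ?_ hF, (componentsCost_union_le _ _).trans ?_, ?_⟩
      · intro K' hK'
        obtain rfl := Finset.mem_singleton.1 hK'
        refine ⟨hfull, ?_⟩
        rw [hj, hset, Set.ncard_coe_finset]
        exact (List.toFinset_card_le _).trans hlen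
      · simp only [List.map_cons, List.sum_cons]
        have : I.componentsCost {K} = I.linkCost K := Finset.sum_singleton _ _
        linarith
      · intro C q hq hC
        rcases List.mem_cons.1 hq with rfl | hq
        · simp only [SteinerTree.OneSided, not_forall] at hC
          obtain ⟨x, hx, y, hy, hxC, hyC⟩ := hC
          refine ⟨K, by simp, ⟨x, ?_, hxC⟩, ⟨y, ?_, hyC⟩⟩
          · rw [hj]
            exact hx
          · rw [hj]
            exact hy
        · obtain ⟨K', hK', hc⟩ := hcov C q hq hC
          exact ⟨K', Finset.mem_union_right _ hK', hc⟩
    -- A piece with only one distinct leaf covers no cut and is dropped.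
    · refine ⟨F, hF, ?_, fun C q hq hC => ?_⟩
      · simp only [List.map_cons, List.sum_cons]
        have := SteinerTree.cost_nonneg I.cost_nonneg p
        linarith
      · rcases List.mem_cons.1 hq with rfl | hq
        · refine absurd (fun x hx y hy hxC => ?_) hC
          obtain rfl := Set.not_nontrivial_iff.1 h2 hx hy
          exact hxC
        · exact hcov C q hq hC

open scoped Classical in
/-- The links of `A` that touch a vertex that can be reached from `r`. -/
noncomputable def touching (I : Instance V L) (A : Finset L) (r : V) : Finset L :=
  A.filter fun l => ∃ v ∈ I.ends l, I.Reach A r v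

lemma mem_touching {A : Finset L} {r : V} {l : L} :
    l ∈ I.touching A r ↔ l ∈ A ∧ ∃ v ∈ I.ends l, I.Reach A r v := by
  simp [touching]

lemma touching_subset_of_reach {A B : Finset L} {r v : V} (hAB : A ⊆ B) (h : I.Reach B r v) :
    I.touching A v ⊆ I.touching B r := fun l hl => by
  obtain ⟨hlA, x, hx, hvx⟩ := mem_touching.1 hl
  exact mem_touching.2 ⟨hAB hlA, x, hx, Relation.ReflTransGen.trans h (hvx.mono hAB)⟩

/-- A shared link would either have an endpoint reachable from both roots or lead from one reachable
set into the other. This makes costs additive over mutually unreachable roots. -/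
lemma disjoint_touching {A : Finset L} {r v : V} (hv : v ∉ I.ringNodes)
    (h : ¬ I.Reach A r v) : Disjoint (I.touching A r) (I.touching A v) := by
  rw [Finset.disjoint_left]
  intro l hl hl'
  obtain ⟨hlA, x, hx, hrx⟩ := mem_touching.1 hl
  obtain ⟨-, y, hy, hvy⟩ := mem_touching.1 hl'
  refine h (Relation.ReflTransGen.trans ?_ (hvy.symm hv))
  by_cases hxy : x = y
  · exact hxy ▸ hrx
  · exact hrx.step (hvy.notMem_ringNodes hv) hlA ((Sym2.mem_and_mem_iff hxy).1 ⟨hx, hy⟩)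

/-- Unless nothing is attached to `r`, a tree with root `r` reaches everything that is. -/
lemma exists_steinerTree (A : Finset L) {r : V} (hr : r ∉ I.ringNodes) :
    (∀ t ∈ I.ringNodes, ¬ I.Attached A r t) ∨
      ∃ τ : SteinerTree V L, τ.Valid I ∧ τ.root = r ∧
        (∀ t ∈ I.ringNodes, I.Attached A r t → t ∈ τ.leaves) ∧
        τ.cost I.cost ≤ I.linkCost (I.touching A r) := by
  classical
  induction A using Finset.strongInduction generalizing r with
  | H A ih =>
  by_cases hlink : ∃ l ∈ A, r ∈ I.ends l
  swap
  · refine .inl ?_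
    rintro t - ⟨v, hv, l, hl, he⟩
    rcases Relation.ReflTransGen.cases_head hv with rfl | ⟨_, ⟨_, l', hl', he'⟩, _⟩
    · exact hlink ⟨l, hl, by rw [he]; simp⟩
    · exact hlink ⟨l', hl', by rw [he']; simp⟩
  obtain ⟨l, hl, hrl⟩ := hlink
  obtain ⟨w, he⟩ := Sym2.mem_iff_exists.1 hrl
  set A' := A.erase l with hA'
  have hss : A' ⊂ A := Finset.erase_ssubset hl
  -- After its last use of `l`, a walk continues from `r` or from `w` without `l`.
  have hreach : ∀ v, I.Reach A r v → I.Reach A' r v ∨ (w ∉ I.ringNodes ∧ I.Reach A' w v) := by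
    intro v hv
    induction hv with
    | refl => exact .inl Relation.ReflTransGen.refl
    | @tail b c _ hbc ih =>
      obtain ⟨hc, l', hl', he'⟩ := hbc
      by_cases hll : l' = l
      · subst hll
        rw [he] at he'
        rcases Sym2.eq_iff.1 he' with ⟨_, rfl⟩ | ⟨rfl, _⟩
        · exact .inr ⟨hc, Relation.ReflTransGen.refl⟩
        · exact .inl Relation.ReflTransGen.refl
      · have hl'' : l' ∈ A' := Finset.mem_erase.2 ⟨hll, hl'⟩
        exact ih.imp (fun h => h.step hc hl'' he') fun h => ⟨h.1, h.2.step hc hl'' he'⟩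
  have hatt : ∀ t ∈ I.ringNodes, I.Attached A r t →
      I.Attached A' r t ∨ (w ∉ I.ringNodes ∧ I.Attached A' w t) ∨ t = w := by
    rintro t ht ⟨v, hv, l', hl', he'⟩
    by_cases hll : l' = l
    · subst hll
      rw [he] at he'
      rcases Sym2.eq_iff.1 he' with ⟨_, h⟩ | ⟨h, _⟩
      · exact .inr (.inr h.symm)
      · exact absurd (h ▸ ht) hr
    · have hl'' : l' ∈ A' := Finset.mem_erase.2 ⟨hll, hl'⟩
      exact (hreach v hv).imp (fun h => ⟨v, h, l', hl'', he'⟩)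
        fun h => .inl ⟨h.1, v, h.2, l', hl'', he'⟩
  have hlr : l ∈ I.touching A r := mem_touching.2 ⟨hl, r, hrl, Relation.ReflTransGen.refl⟩
  have hlA' : ∀ v, l ∉ I.touching A' v := fun v h =>
    Finset.notMem_erase l A (mem_touching.1 h).1
  have hsub : I.touching A' r ⊆ I.touching A r :=
    touching_subset_of_reach hss.1 Relation.ReflTransGen.refl
  have hcost_le : ∀ B : Finset L, B ⊆ I.touching A r → l ∉ B →
      I.cost l + I.linkCost B ≤ I.linkCost (I.touching A r) := fun B hB hlB => by
    rw [linkCost, ← Finset.sum_insert hlB]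
    exact linkCost_mono (Finset.insert_subset hlr hB)
  have hcost_edge : ∀ τ : SteinerTree V L,
      (SteinerTree.edge r l τ).cost I.cost = I.cost l + τ.cost I.cost := fun τ => by
    simp [SteinerTree.cost, SteinerTree.links]
  have hcost_join : ∀ τ τ' : SteinerTree V L,
      (SteinerTree.join τ τ').cost I.cost = τ.cost I.cost + τ'.cost I.cost := fun τ τ' => by
    simp [SteinerTree.cost, SteinerTree.links]
  have h1 := ih A' hss hr
  by_cases hw : w ∈ I.ringNodes
  · right
    have hleaf : (SteinerTree.leaf w : SteinerTree V L).cost I.cost = 0 := by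
      simp [SteinerTree.cost, SteinerTree.links]
    rcases h1 with h1 | ⟨τ, hv, hroot, hleaves, hcost⟩
    · refine ⟨.edge r l (.leaf w), ⟨hr, he, hw⟩, rfl, fun t ht h => ?_, ?_⟩
      · rcases hatt t ht h with h | h | h
        · exact absurd h (h1 t ht)
        · exact absurd hw h.1
        · simp [SteinerTree.leaves, h]
      · have := hcost_le ∅ (by simp) (by simp)
        rw [hcost_edge, hleaf]
        simpa [linkCost] using this
    · refine ⟨.join τ (.edge r l (.leaf w)), ⟨hroot, hroot ▸ hr, hv, hr, he, hw⟩, hroot,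
        fun t ht h => ?_, ?_⟩
      · rcases hatt t ht h with h | h | h
        · exact List.mem_append_left _ (hleaves t ht h)
        · exact absurd hw h.1
        · simp [SteinerTree.leaves, h]
      · have := hcost_le _ hsub (hlA' r)
        rw [hcost_join, hcost_edge, hleaf]
        linarith
  · have hatt' : ∀ t ∈ I.ringNodes, I.Attached A r t → I.Attached A' r t ∨ I.Attached A' w t :=
      fun t ht h => (hatt t ht h).imp_right fun h => (h.resolve_right fun h => hw (h ▸ ht)).2
    -- If `w` gives access to no new ring node, `l` can be discarded.
    have of_absorbed : (∀ t ∈ I.ringNodes, I.Attached A' w t → I.Attached A' r t) →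
        (∀ t ∈ I.ringNodes, ¬ I.Attached A r t) ∨
          ∃ τ : SteinerTree V L, τ.Valid I ∧ τ.root = r ∧
            (∀ t ∈ I.ringNodes, I.Attached A r t → t ∈ τ.leaves) ∧
            τ.cost I.cost ≤ I.linkCost (I.touching A r) := by
      intro habs
      have h' : ∀ t ∈ I.ringNodes, I.Attached A r t → I.Attached A' r t :=
        fun t ht h => (hatt' t ht h).elim id (habs t ht)
      rcases h1 with h1 | ⟨τ, hv, hroot, hleaves, hcost⟩
      · exact .inl fun t ht h => h1 t ht (h' t ht h)
      · exact .inr ⟨τ, hv, hroot, fun t ht h => hleaves t ht (h' t ht h),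
          hcost.trans (linkCost_mono hsub)⟩
    by_cases hrw : I.Reach A' r w
    · exact of_absorbed fun t _ h => h.of_reach hrw
    rcases ih A' hss hw with h2 | ⟨τ₂, hv₂, hroot₂, hleaves₂, hcost₂⟩
    · exact of_absorbed fun t ht h => absurd h (h2 t ht)
    have hsub₂ : I.touching A' w ⊆ I.touching A r :=
      touching_subset_of_reach hss.1 (Relation.ReflTransGen.single ⟨hw, l, hl, he⟩)
    have hvalid : (SteinerTree.edge r l τ₂).Valid I := ⟨hr, hroot₂.symm ▸ he, hv₂⟩
    right
    rcases h1 with h1 | ⟨τ, hv, hroot, hleaves, hcost⟩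
    · refine ⟨.edge r l τ₂, hvalid, rfl, fun t ht h => ?_, ?_⟩
      · exact hleaves₂ t ht ((hatt' t ht h).resolve_left (h1 t ht))
      · have := hcost_le _ hsub₂ (hlA' w)
        rw [hcost_edge]
        linarith
    · refine ⟨.join τ (.edge r l τ₂), ⟨hroot, hroot ▸ hr, hv, hvalid⟩, hroot, fun t ht h => ?_, ?_⟩
      · rcases hatt' t ht h with h | h
        · exact List.mem_append_left _ (hleaves t ht h)
        · exact List.mem_append_right _ (hleaves₂ t ht h)
      -- As `w` is not reachable from `r` without `l`, the two subtrees are charged to disjoint sets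
      -- of links, neither containing `l`.
      · have := hcost_le _ (Finset.union_subset hsub hsub₂)
          (by simp only [Finset.mem_union, hlA', or_self, not_false_eq_true])
        rw [linkCost, Finset.sum_union (disjoint_touching hw hrw)] at this
        rw [hcost_join, hcost_edge]
        simp only [linkCost] at *
        linarith

variable {k : ℕ}

lemma exists_isSmall_of_root (S : Finset L) (hk : 0 < k) {r : V} (hr : r ∉ I.ringNodes) :
    ∃ F, I.IsSmall (2 ^ k) F ∧
      I.componentsCost F ≤ (1 + 1 / k) * I.linkCost (I.touching S r) ∧
      ∀ C : Set V, ∀ x ∈ I.ringNodes, ∀ y ∈ I.ringNodes, x ∈ C → y ∉ C →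
        I.Attached S r x → I.Attached S r y → ∃ K ∈ F, I.Covers (K : Set L) C := by
  have hk' : (0 : ℝ) ≤ 1 + 1 / k := by positivity
  rcases exists_steinerTree S hr with h | ⟨τ, hv, _, hleaves, hcost⟩
  · refine ⟨∅, by simp [IsSmall], ?_, fun C x hx _ _ _ _ h' => absurd h' (h x hx)⟩
    simpa [componentsCost] using mul_nonneg hk' (linkCost_nonneg _)
  · obtain ⟨P, hP, hPcost, hPC⟩ := SteinerTree.exists_pieces I.cost_nonneg hk hv
    obtain ⟨F, hF, hFcost, hcov⟩ := exists_isSmall_of_pieces P hP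
    refine ⟨F, hF, hFcost.trans (hPcost.trans (mul_le_mul_of_nonneg_left hcost hk')),
      fun C x hx y hy hxC hyC hxa hya => ?_⟩
    by_contra hcon
    refine hyC (hPC C (fun p hp => ?_) x (hleaves x hx hxa) y (hleaves y hy hya) hxC)
    by_contra hp'
    exact hcon (hcov C p hp hp')

-- A root reachable from an earlier one attaches nothing new; otherwise its touching links are
-- disjoint from all earlier ones and the costs add.
open scoped Classical in
lemma exists_isSmall_of_roots (S : Finset L) (hk : 0 < k) (W : Finset V)
    (hW : ∀ r ∈ W, r ∉ I.ringNodes) :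
    ∃ F, I.IsSmall (2 ^ k) F ∧
      I.componentsCost F ≤ (1 + 1 / k) * I.linkCost (W.biUnion (I.touching S)) ∧
      ∀ C : Set V, ∀ r ∈ W, ∀ x ∈ I.ringNodes, ∀ y ∈ I.ringNodes, x ∈ C → y ∉ C →
        I.Attached S r x → I.Attached S r y → ∃ K ∈ F, I.Covers (K : Set L) C := by
  have hk' : (0 : ℝ) ≤ 1 + 1 / k := by positivity
  induction W using Finset.induction_on with
  | empty => exact ⟨∅, by simp [IsSmall], by simp [componentsCost, linkCost], by simp⟩
  | insert r W _ ih =>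
    obtain ⟨F, hF, hcost, hcov⟩ := ih fun r' h => hW r' (Finset.mem_insert_of_mem h)
    have hr := hW r (Finset.mem_insert_self _ _)
    by_cases hreach : ∃ r' ∈ W, I.Reach S r' r
    · obtain ⟨r', hr'W, hr'⟩ := hreach
      refine ⟨F, hF, hcost.trans (mul_le_mul_of_nonneg_left (linkCost_mono ?_) hk'),
        fun C q hq x hx y hy hxC hyC hxa hya => ?_⟩
      · exact Finset.biUnion_subset_biUnion_of_subset_left _ (Finset.subset_insert _ _)
      · rcases Finset.mem_insert.1 hq with rfl | hq
        · exact hcov C r' hr'W x hx y hy hxC hyC (hxa.of_reach hr') (hya.of_reach hr')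
        · exact hcov C q hq x hx y hy hxC hyC hxa hya
    · obtain ⟨G, hG, hGcost, hGcov⟩ := exists_isSmall_of_root S hk hr
      refine ⟨G ∪ F, hG.union hF, (componentsCost_union_le _ _).trans ?_,
        fun C q hq x hx y hy hxC hyC hxa hya => ?_⟩
      · have hdis : Disjoint (I.touching S r) (W.biUnion (I.touching S)) := by
          rw [Finset.disjoint_biUnion_right]
          intro r' hr'
          exact (disjoint_touching hr fun h => hreach ⟨r', hr', h⟩).symm
        rw [Finset.biUnion_insert, linkCost, Finset.sum_union hdis, mul_add]
        exact add_le_add hGcost hcost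
      · rcases Finset.mem_insert.1 hq with rfl | hq
        · obtain ⟨K, hK, h⟩ := hGcov C x hx y hy hxC hyC hxa hya
          exact ⟨K, Finset.mem_union_left _ hK, h⟩
        · obtain ⟨K, hK, h⟩ := hcov C q hq x hx y hy hxC hyC hxa hya
          exact ⟨K, Finset.mem_union_right _ hK, h⟩

/-! ### Single links between ring nodes as full components. -/

section Singleton

variable {l : L} {x y : V}

lemma joined_singleton (he : I.ends l = s(x, y)) (hx : x ∈ I.ringNodes) (hy : y ∈ I.ringNodes) :
    I.joined {l} = {x, y} := by
  ext v
  simp only [joined, verts, Set.mem_singleton_iff, exists_eq_left, he, Sym2.mem_iff,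
    Set.mem_inter_iff, Set.mem_ofPred_eq, Set.mem_insert_iff]
  constructor
  · exact fun h => h.1
  · rintro (rfl | rfl) <;> simp [hx, hy]

lemma isFullComponent_singleton (he : I.ends l = s(x, y)) (hxy : x ≠ y) (hx : x ∈ I.ringNodes)
    (hy : y ∈ I.ringNodes) : I.IsFullComponent {l} := by
  have hverts : verts I.ends {l} = {x, y} := by
    ext v
    simp [verts, he]
  refine ⟨⟨Set.singleton_nonempty l, ?_, Set.injOn_singleton _ _, ⟨?_, ?_⟩⟩, fun v hv => ?_⟩
  · rintro e rfl
    rw [he]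
    exact hxy
  · rw [Set.image_singleton, he, hverts, SimpleGraph.connected_iff_exists_forall_reachable]
    refine ⟨⟨x, by simp⟩, ?_⟩
    rintro ⟨v, rfl | rfl⟩
    · exact SimpleGraph.Reachable.refl _
    · refine SimpleGraph.Adj.reachable ?_
      rw [SimpleGraph.comap_adj, SimpleGraph.fromEdgeSet_adj]
      exact ⟨rfl, hxy⟩
  · refine SimpleGraph.IsAcyclic.induce ?_ _
    rw [Set.image_singleton, he, SimpleGraph.isAcyclic_iff_forall_isBridge]
    intro e
    induction e with | h a b => ?_
    intro hab
    have hab' := (SimpleGraph.fromEdgeSet_adj _).1 hab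
    rw [SimpleGraph.isBridge_iff]
    have hbot : (SimpleGraph.fromEdgeSet {s(x, y)}).deleteEdges {s(a, b)} = ⊥ := by
      ext c d
      simp only [SimpleGraph.deleteEdges_adj, SimpleGraph.fromEdgeSet_adj,
        Set.mem_singleton_iff, SimpleGraph.bot_adj, iff_false, not_and, not_not]
      rintro ⟨h, _⟩
      exact h.trans (Set.mem_singleton_iff.1 hab'.1).symm
    rw [hbot, SimpleGraph.reachable_bot]
    exact hab'.2
  · have hdeg : degree I.ends {l} v = 1 := by
      rw [degree, Set.ncard_eq_one]
      obtain ⟨l', rfl, hv'⟩ := hv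
      exact ⟨l', Set.ext fun e => ⟨fun h => h.1, by rintro rfl; exact ⟨rfl, hv'⟩⟩⟩
    refine iff_of_true ?_ hdeg
    rw [hverts] at hv
    rcases hv with rfl | rfl
    exacts [hx, hy]

end Singleton

open scoped Classical in
lemma exists_isSmall_of_direct (S : Finset L) (hk : 0 < k) :
    ∃ F, I.IsSmall (2 ^ k) F ∧
      I.componentsCost F ≤ I.linkCost (S.filter fun l => ∀ v ∈ I.ends l, v ∈ I.ringNodes) ∧
      ∀ C : Set V, ∀ l ∈ S, ∀ x ∈ I.ringNodes, ∀ y ∈ I.ringNodes, x ∈ C → y ∉ C →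
        I.ends l = s(x, y) → ∃ K ∈ F, I.Covers (K : Set L) C := by
  refine ⟨(S.filter fun l => (∀ v ∈ I.ends l, v ∈ I.ringNodes) ∧ ¬ (I.ends l).IsDiag).image
    fun l => {l}, fun K hK => ?_, ?_, fun C l hl x hx y hy hxC hyC he => ?_⟩
  · obtain ⟨l, hl, rfl⟩ := Finset.mem_image.1 hK
    obtain ⟨-, hring, hd⟩ := Finset.mem_filter.1 hl
    obtain ⟨x, y, he⟩ := (Sym2.exists.1 ⟨I.ends l, rfl⟩ : ∃ a b, I.ends l = s(a, b))
    have hx := hring x (by rw [he]; simp)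
    have hy := hring y (by rw [he]; simp)
    have hxy : x ≠ y := by
      rintro rfl
      exact hd (by rw [he]; rfl)
    rw [Finset.coe_singleton]
    refine ⟨isFullComponent_singleton he hxy hx hy, ?_⟩
    rw [joined_singleton he hx hy, Set.ncard_pair hxy]
    calc 2 = 2 ^ 1 := rfl
      _ ≤ 2 ^ k := Nat.pow_le_pow_right (by norm_num) hk
  · rw [componentsCost, Finset.sum_image fun _ _ _ _ h => Finset.singleton_injective h]
    simp only [linkCost, Finset.sum_singleton]
    refine Finset.sum_le_sum_of_subset_of_nonneg (fun l hl => ?_) fun l _ _ => I.cost_nonneg l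
    simp only [Finset.mem_filter] at hl ⊢
    exact ⟨hl.1, hl.2.1⟩
  · have hxy : x ≠ y := by
      rintro rfl
      exact hyC hxC
    refine ⟨{l}, Finset.mem_image_of_mem _ (Finset.mem_filter.2 ⟨hl, ?_, ?_⟩), ?_⟩
    · rw [he]
      intro v hv
      rcases Sym2.mem_iff.1 hv with rfl | rfl
      exacts [hx, hy]
    · rw [he]
      exact hxy
    · rw [Finset.coe_singleton, Covers, joined_singleton he hx hy]
      exact ⟨⟨x, by simp, hxC⟩, ⟨y, by simp, hyC⟩⟩

/-- At `1 + 1 / k` times the cost of `S`, full components that join at most `2 ^ k` ring nodes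
cover all that `S` covers through vertices outside the ring or by single links. -/
lemma exists_isSmall [Finite V] (S : Finset L) (hk : 0 < k) :
    ∃ F, I.IsSmall (2 ^ k) F ∧ I.componentsCost F ≤ (1 + 1 / k) * I.linkCost S ∧
      ∀ C : Set V, ∀ x ∈ I.ringNodes, ∀ y ∈ I.ringNodes, x ∈ C → y ∉ C →
        ((∃ l ∈ S, I.ends l = s(x, y)) ∨
          ∃ r ∉ I.ringNodes, I.Attached S r x ∧ I.Attached S r y) →
        ∃ K ∈ F, I.Covers (K : Set L) C := by
  classical
  have := Fintype.ofFinite V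
  obtain ⟨F, hF, hFcost, hFcov⟩ := exists_isSmall_of_roots (I := I) S hk
    (Finset.univ.filter fun r => r ∉ I.ringNodes) (by simp)
  obtain ⟨G, hG, hGcost, hGcov⟩ := exists_isSmall_of_direct (I := I) S hk
  refine ⟨F ∪ G, hF.union hG, (componentsCost_union_le _ _).trans ?_,
    fun C x hx y hy hxC hyC h => ?_⟩
  -- Links touching a vertex outside the ring and links within the ring are disjoint; only the
  -- former incur the factor `1 + 1 / k`.
  · set A := (Finset.univ.filter fun r => r ∉ I.ringNodes).biUnion (I.touching S) with hA
    set B := S.filter fun l => ∀ v ∈ I.ends l, v ∈ I.ringNodes with hB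
    have hdis : Disjoint A B := by
      rw [Finset.disjoint_left]
      intro l hlA hlB
      obtain ⟨r, hr, hlr⟩ := Finset.mem_biUnion.1 hlA
      obtain ⟨-, v, hv, hrv⟩ := mem_touching.1 hlr
      exact hrv.notMem_ringNodes (Finset.mem_filter.1 hr).2 ((Finset.mem_filter.1 hlB).2 v hv)
    have hAB : A ∪ B ⊆ S := Finset.union_subset
      (Finset.biUnion_subset.2 fun r _ l hl => (mem_touching.1 hl).1) (Finset.filter_subset _ _)
    have hsum : I.linkCost A + I.linkCost B ≤ I.linkCost S := by
      have := linkCost_mono (I := I) hAB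
      rwa [linkCost, Finset.sum_union hdis] at this
    have hk' : (0 : ℝ) ≤ 1 / k := by positivity
    have hB0 := linkCost_nonneg (I := I) B
    have hGcost' : I.componentsCost G ≤ I.linkCost B := hGcost.trans_eq (by rw [hB]; congr)
    linarith [mul_le_mul_of_nonneg_left hsum (by linarith : (0 : ℝ) ≤ 1 + 1 / k),
      mul_nonneg hk' hB0]
  · rcases h with ⟨l, hl, he⟩ | ⟨r, hr, hxa, hya⟩
    · obtain ⟨K, hK, h⟩ := hGcov C l hl x hx y hy hxC hyC he
      exact ⟨K, Finset.mem_union_right _ hK, h⟩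
    · obtain ⟨K, hK, h⟩ := hFcov C r (by simp [hr]) x hx y hy hxC hyC hxa hya
      exact ⟨K, Finset.mem_union_left _ hK, h⟩

end Instance



/-! ### Dangerous ring-cuts and solutions -/

namespace Instance

variable {V L : Type*} {I : Instance V L}

lemma finite_index (I : Instance V L) : Finite (ZMod I.n) :=
  have : NeZero I.n := ⟨I.n_pos.ne'⟩
  inferInstance

lemma exists_ring_leaving {C : Set V} {i j : ZMod I.n} (hi : I.ring i ∈ C) (hj : I.ring j ∉ C) :
    ∃ a, I.ring a ∈ C ∧ I.ring (a + 1) ∉ C := by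
  have : NeZero I.n := ⟨I.n_pos.ne'⟩
  by_contra! h
  have hm : ∀ m : ℕ, I.ring (i + m) ∈ C := by
    intro m
    induction m with
    | zero => simpa using hi
    | succ m ih =>
      have := h _ ih
      rwa [add_assoc, ← Nat.cast_succ] at this
  refine hj ?_
  have := hm (j - i).val
  rwa [ZMod.natCast_zmod_val, add_sub_cancel] at this

/-- Going around the ring, one leaves `C` once and its complement once, by edges with different
indices. -/
lemma two_le_ncard_cut {C : Set V} {x y : V} (hx : x ∈ I.ringNodes) (hy : y ∈ I.ringNodes)
    (hxC : x ∈ C) (hyC : y ∉ C) : 2 ≤ (cut I.ringEnds C).ncard := by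
  obtain ⟨i, rfl⟩ := hx
  obtain ⟨j, rfl⟩ := hy
  have := I.finite_index
  obtain ⟨a, ha, ha'⟩ := exists_ring_leaving hxC hyC
  obtain ⟨b, hb, hb'⟩ := exists_ring_leaving (C := Cᶜ) hyC (by simpa using hxC)
  have hab : a ≠ b := by
    rintro rfl
    exact hb ha
  rw [← Set.ncard_pair hab]
  refine Set.ncard_le_ncard ?_ (Set.toFinite _)
  rintro e (rfl | rfl)
  · exact ⟨_, ha, _, ha', rfl⟩
  · exact ⟨_, by simpa using hb', _, hb, Sym2.eq_swap⟩

lemma cut_ringEnds_congr {C D : Set V} (h : ∀ x ∈ I.ringNodes, x ∈ C ↔ x ∈ D) :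
    cut I.ringEnds C = cut I.ringEnds D := by
  have aux : ∀ {C D : Set V}, (∀ x ∈ I.ringNodes, x ∈ C ↔ x ∈ D) →
      cut I.ringEnds C ⊆ cut I.ringEnds D := by
    rintro C D h i ⟨u, hu, v, hv, he⟩
    have hring : ∀ x ∈ I.ringEnds i, x ∈ I.ringNodes := by
      intro x hx
      rcases Sym2.mem_iff.1 hx with rfl | rfl <;> exact ⟨_, rfl⟩
    exact ⟨u, (h u (hring u (by rw [he]; simp))).1 hu, v,
      fun hvD => hv ((h v (hring v (by rw [he]; simp))).2 hvD), he⟩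
  exact (aux h).antisymm (aux fun x hx => (h x hx).symm)

/-- A full component that covers `C` has a link in the cut `δ(C)`. -/
lemma Covers.exists_mem_cut {K : Set L} {C : Set V} (hK : I.IsFullComponent K)
    (h : I.Covers K C) : ∃ l ∈ K, l ∈ cut I.ends C := by
  obtain ⟨⟨x, ⟨hx, -⟩, hxC⟩, ⟨y, ⟨hy, -⟩, hyC⟩⟩ := h
  obtain ⟨p⟩ := hK.1.isTree.connected.preconnected ⟨x, hx⟩ ⟨y, hy⟩
  by_contra! hcon
  have key : ∀ {a b : verts I.ends K}
      (_ : ((SimpleGraph.fromEdgeSet (I.ends '' K)).induce (verts I.ends K)).Walk a b),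
      (a : V) ∈ C → (b : V) ∈ C := by
    intro a b p
    induction p with
    | nil => exact id
    | @cons a c b h _ ih =>
      intro ha
      refine ih ?_
      by_contra hc
      rw [SimpleGraph.comap_adj, SimpleGraph.fromEdgeSet_adj] at h
      obtain ⟨⟨l, hl, he⟩, -⟩ := h
      exact hcon l hl ⟨a, ha, c, hc, he⟩
  exact hyC (key p hxC)

lemma isSolution_of_covers [Finite V] [Finite L] {F : Finset (Finset L)}
    (hF : ∀ K ∈ F, I.IsFullComponent (K : Set L))
    (hcov : ∀ C, I.IsDangerousRingCut C → ∃ K ∈ F, I.Covers (K : Set L) C) :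
    I.IsSolution {l | ∃ K ∈ F, l ∈ K} := by
  intro u hu v hv huv
  have := I.finite_index
  refine hasEdgeDisjointPaths_of_le_cut huv fun C huC hvC => ?_
  set X : Set (ZMod I.n ⊕ L) := Set.range Sum.inl ∪ Sum.inr '' {l | ∃ K ∈ F, l ∈ K} with hX
  have hle : Sum.inl '' cut I.ringEnds C ⊆ X ∩ cut I.allEnds C := by
    rintro _ ⟨i, hi, rfl⟩
    exact ⟨.inl ⟨i, rfl⟩, hi⟩
  have hcard : (Sum.inl '' cut I.ringEnds C : Set (ZMod I.n ⊕ L)).ncard =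
      (cut I.ringEnds C).ncard := Set.ncard_image_of_injective _ Sum.inl_injective
  have h2 := two_le_ncard_cut (I.R_subset hu) (I.R_subset hv) huC hvC
  by_cases h3 : 3 ≤ (cut I.ringEnds C).ncard
  · exact (h3.trans_eq hcard.symm).trans (Set.ncard_le_ncard hle (Set.toFinite _))
  have hcongr : cut I.ringEnds (C ∩ I.ringNodes) = cut I.ringEnds C :=
    cut_ringEnds_congr fun x hx => ⟨fun h => h.1, fun h => ⟨h, hx⟩⟩
  obtain ⟨K, hK, hKC⟩ := hcov (C ∩ I.ringNodes) ⟨Set.inter_subset_right,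
    by rw [hcongr]; omega, ⟨u, ⟨huC, I.R_subset hu⟩, hu⟩, ⟨v, hv, fun h => hvC h.1⟩⟩
  have hKC' : I.Covers (K : Set L) C := by
    obtain ⟨⟨x, hx, hxC⟩, ⟨y, hy, hyC⟩⟩ := hKC
    exact ⟨⟨x, hx, hxC.1⟩, ⟨y, hy, fun h => hyC ⟨h, hy.2⟩⟩⟩
  obtain ⟨l, hl, hlC⟩ := hKC'.exists_mem_cut (hF K hK)
  have hins : insert (Sum.inr l) (Sum.inl '' cut I.ringEnds C) ⊆ X ∩ cut I.allEnds C :=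
    Set.insert_subset ⟨.inr ⟨l, ⟨K, hK, hl⟩, rfl⟩, hlC⟩ hle
  have hnot : (Sum.inr l : ZMod I.n ⊕ L) ∉ Sum.inl '' cut I.ringEnds C := by simp
  have := Set.ncard_le_ncard hins (Set.toFinite _)
  rw [Set.ncard_insert_of_notMem hnot (Set.toFinite _), hcard] at this
  omega

/-- A solution has a link in every cut that separates two terminals and contains only two ring
edges. -/
lemma IsSolution.exists_mem_cut {S : Set L} (hS : I.IsSolution S) {C : Set V} {u v : V}
    (hu : u ∈ I.R) (hv : v ∈ I.R) (huC : u ∈ C) (hvC : v ∉ C)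
    (h2 : (cut I.ringEnds C).ncard = 2) : ∃ l ∈ S, l ∈ cut I.ends C := by
  have := I.finite_index
  by_contra! hcon
  have huv : u ≠ v := by
    rintro rfl
    exact hvC huC
  obtain ⟨P, hP, hdis⟩ := hS u hu v hv huv
  -- Without a link in the cut, the three disjoint paths would need three distinct ring edges in it.
  have hex : ∀ i, ∃ e, Sum.inl e ∈ (P i).map Prod.fst ∧ e ∈ cut I.ringEnds C := by
    intro i
    obtain ⟨e, he, heC⟩ := (hP i).1.1.exists_mem_cut huC hvC
    rcases (hP i).2 e he with ⟨a, rfl⟩ | ⟨l, hl, rfl⟩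
    · exact ⟨a, he, heC⟩
    · exact absurd heC (hcon l hl)
  choose e he heC using hex
  have hinj : Function.Injective e := by
    intro i j hij
    by_contra hne
    exact hdis hne (he i) (hij ▸ he j)
  have hle := Set.ncard_le_ncard (Set.range_subset_iff.2 heC) (Set.toFinite _)
  rw [← Set.image_univ, Set.ncard_image_of_injective _ hinj, Set.ncard_univ, Nat.card_fin] at hle
  omega

/-- A solution connects the two sides of a dangerous ring-cut by a link, or through vertices
outside the ring. -/
lemma IsSolution.exists_connection {S : Finset L} (hS : I.IsSolution (S : Set L)) {C : Set V}
    (hC : I.IsDangerousRingCut C) :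
    ∃ x ∈ I.ringNodes, ∃ y ∈ I.ringNodes, x ∈ C ∧ y ∉ C ∧
      ((∃ l ∈ S, I.ends l = s(x, y)) ∨
        ∃ r ∉ I.ringNodes, I.Attached S r x ∧ I.Attached S r y) := by
  obtain ⟨hCR, h2, ⟨u, huC, hu⟩, ⟨v, hv, hvC⟩⟩ := hC
  -- Absorbing all non-ring vertices connected to `C` leaves the ring edges of the cut unchanged,
  -- while a link leaving `D` must end at a ring node outside `C`.
  set D : Set V := C ∪ {x | x ∉ I.ringNodes ∧ ∃ c ∈ C, I.Attached S x c} with hD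
  have hring : ∀ x ∈ I.ringNodes, x ∈ D ↔ x ∈ C := fun x hx =>
    ⟨fun h => h.elim id fun h => absurd hx h.1, .inl⟩
  obtain ⟨l, hl, x, hx, y, hy, he⟩ := hS.exists_mem_cut hu hv (.inl huC)
    (fun h => hvC ((hring v (I.R_subset hv)).1 h)) (by rw [cut_ringEnds_congr hring, h2])
  rcases hx with hx | ⟨hxR, c, hc, hxc⟩
  · by_cases hyR : y ∈ I.ringNodes
    · exact ⟨x, hCR hx, y, hyR, hx, fun h => hy (.inl h), .inl ⟨l, hl, he⟩⟩
    · exact absurd (.inr ⟨hyR, x, hx, y, Relation.ReflTransGen.refl, l, hl,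
        he.trans Sym2.eq_swap⟩) hy
  · by_cases hyR : y ∈ I.ringNodes
    · exact ⟨c, hCR hc, y, hyR, hc, fun h => hy (.inl h),
        .inr ⟨x, hxR, hxc, x, Relation.ReflTransGen.refl, l, hl, he⟩⟩
    · exact absurd (.inr ⟨hyR, c, hc, hxc.of_reach
        (Relation.ReflTransGen.single ⟨hxR, l, hl, he.trans Sym2.eq_swap⟩)⟩) hy

/-- Every solution can be turned into a `2 ^ k`-restricted one at `1 + 1 / k` times the cost. -/
theorem IsSolution.exists_isRestrictedSolution [Finite V] [Finite L] {S : Finset L}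
    (hS : I.IsSolution (S : Set L)) {k : ℕ} (hk : 0 < k) :
    ∃ F, I.IsRestrictedSolution (2 ^ k) F ∧
      I.componentsCost F ≤ (1 + 1 / k) * I.linkCost S := by
  obtain ⟨F, hF, hcost, hcov⟩ := exists_isSmall (I := I) S hk
  have hcov' : ∀ C, I.IsDangerousRingCut C → ∃ K ∈ F, I.Covers (K : Set L) C := by
    intro C hC
    obtain ⟨x, hx, y, hy, hxC, hyC, h⟩ := hS.exists_connection hC
    exact hcov C x hx y hy hxC hyC h
  exact ⟨F, ⟨fun K hK => (hF K hK).1, fun K hK => (hF K hK).2, hcov',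
    isSolution_of_covers (fun K hK => (hF K hK).1) hcov'⟩, hcost⟩

end Instance

end SRAP

theorem mainTheorem8 {V L : Type*} [Finite V] [Finite L] (I : SRAP.Instance V L)
    (ε : ℝ) (hε : 0 < ε) (S : Finset L) (hS : I.IsOptimal S) :
    (∃ F, I.IsOptimalRestricted (2 ^ ⌈1 / ε⌉₊) F) ∧
      ∀ F, I.IsOptimalRestricted (2 ^ ⌈1 / ε⌉₊) F →
        I.componentsCost F ≤ (1 + ε) * I.linkCost S := by
  have hk : 0 < ⌈1 / ε⌉₊ := Nat.ceil_pos.2 (by positivity)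
  have hkε : 1 / (⌈1 / ε⌉₊ : ℝ) ≤ ε := (one_div_le hε (by exact_mod_cast hk)).1 (Nat.le_ceil _)
  obtain ⟨F₀, hF₀, hcost⟩ := hS.1.exists_isRestrictedSolution hk
  refine ⟨?_, fun F hF => (hF.2 F₀ hF₀).trans (hcost.trans ?_)⟩
  -- There are only finitely many collections of link sets, so a cheapest one exists.
  · obtain ⟨F, hF, hmin⟩ := Set.exists_min_image {F | I.IsRestrictedSolution (2 ^ ⌈1 / ε⌉₊) F}
      I.componentsCost (Set.toFinite _) ⟨F₀, hF₀⟩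
    exact ⟨F, hF, hmin⟩
  · exact mul_le_mul_of_nonneg_right (by linarith) (SRAP.Instance.linkCost_nonneg S)
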